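/- **Setting.** All sequences are finite nonempty sequences of integers. A *typical sequence* is a sequence obtained from some integer sequence by exhaustively applying two operations: (a) replace two equal consecutive elements by one; (b) if $j-i\ge 2$ and either $s(i)\le s(k)\le s(j)$ for all $i\le k\le j$ or $s(i)\ge s(k)\ge s(j)$ for all $i\le k\le j$, remove all elements strictly between positions $i$ and $j$. An *extension* of $s$ is obtained by repeating each element of $s$ one or more times. A sequence $s$ *dominates* $t$ if there are extensions $s^*$ of $s$ and $t^*$ of $t$ of the same length with $s^*(k)\le t^*(k)$ for all $k$. The *merge matrix* of $r$ (of length $m$) and $c$ (of length $n$) is the $m\times n$ matrix $M[i,j]=r(i)+c(j)$. A *path* in $M$ is a sequence $p$ of indices of $M$ from $(1,1)$ to $(m,n)$ in which $(i,j)$ is always followed by $(i+1,j)$, $(i,j+1)$ or $(i+1,j+1)$; $M[p]$ is the sequence of entries of $M$ along $p$. A path $p$ is *dominating* if $M[p]$ dominates $M[q]$ for every path $q$ in $M$. **Algorithm (Split-and-Chop).** Choose any $i$ with $r(i)=\min r$ and any $j$ with $c(j)=\min c$. Return Chop-bottom on $M[1..i,1..j]$ followed by Chop-top on $M[i..m,j..n]$,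 with the shared index $(i,j)$ listed once. *Chop-bottom* on $M[1..m',1..n']$: if $m'\le 2$, return $(1,1),\dots,(m',1),(m',2),\dots,(m',n')$; else if $n'\le 2$, return $(1,1),\dots,(1,n'),(2,n'),\dots,(m',n')$; else if $M[m'-2,n'-1]\le M[m'-1,n'-2]$, return Chop-bottom on $M[1..m'-2,1..n']$ followed by $(m'-1,n'),(m',n')$; else return Chop-bottom on $M[1..m',1..n'-2]$ followed by $(m',n'-1),(m',n')$. *Chop-top* on $M[i'..m,j'..n]$: if there are at most two rows, return $(i',j'),\dots,(i',n),(i'+1,n),\dots,(m,n)$; else if there are at most two columns, return $(i',j'),\dots,(m,j'),(m,j'+1),\dots,(m,n)$; else if $M[i'+2,j'+1]\le M[i'+1,j'+2]$, return $(i',j'),(i'+1,j')$ followed by Chop-top on $M[i'+2..m,j'..n]$; else return $(i',j'),(i',j'+1)$ followed by Chop-top on $M[i'..m,j'+2..n]$. **Claim.** There are a single program for a unit-cost integer random access machine (with addition, subtraction, comparison and indirect addressing) and an absolute constant $C$ such that for all typical sequences $r$ and $c$ of lengths $m\ge 1$ and $n\ge 1$: for every choice of $i$ and $j$ the output of Split-and-Chop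 is a dominating path in the merge matrix of $r$ and $c$; and, given $r$ and $c$, the program outputs the path that Split-and-Chop yields for some admissible choice of $i$ and $j$ after at most $C\,(m+n)$ steps. In particular, a dominating path in the merge matrix of $r$ and $c$ can be found in time $O(m+n)$. -/

import Mathlib

namespace MergeDom

/-! ### Integer sequences

A finite integer sequence is a `List ℤ`; positions are counted from `1`. -/

/-- The element `s(k)` of a sequence, for `1 ≤ k ≤ length s`. -/
def elt (s : List ℤ) (k : ℕ) : ℤ := s.getD (k - 1) 0

/-- `i ∈ argmin(s)`. -/
def IsArgmin (s : List ℤ) (i : ℕ) : Prop :=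
  1 ≤ i ∧ i ≤ s.length ∧ ∀ k, 1 ≤ k → k ≤ s.length → elt s i ≤ elt s k

/-- `t` is an extension of `s`: a concatenation of nonempty blocks, the `k`-th block
consisting of copies of the `k`-th element of `s`. -/
def IsExtension (t s : List ℤ) : Prop :=
  ∃ blocks : List (List ℤ), t = blocks.flatten ∧
    List.Forall₂ (fun b a => b ≠ [] ∧ ∀ x ∈ b, x = a) blocks s

/-- `r` dominates `s`: some extensions `r'` of `r` and `s'` of `s` have the same length and
satisfy `r' ≤ s'` position by position (`List.Forall₂` includes equality of lengths). -/
def Dominates (r s : List ℤ) : Prop :=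
  ∃ r' s' : List ℤ, IsExtension r' r ∧ IsExtension s' s ∧ List.Forall₂ (· ≤ ·) r' s'

/-! ### Typical sequences -/

/-- One application of one of the two operations that define typical sequences. -/
inductive TypStep : List ℤ → List ℤ → Prop
  /-- Removal of a consecutive repetition. -/
  | removeRepetition (u v : List ℤ) (a : ℤ) :
      TypStep (u ++ a :: a :: v) (u ++ a :: v)
  /-- Typical operation: remove the (at least one) elements strictly between two positions,
  when all of them lie between the values at these positions. -/
  | typicalOp (u w v : List ℤ) (a b : ℤ) (hw : w ≠ [])
      (h : (∀ x ∈ w, a ≤ x ∧ x ≤ b) ∨ (∀ x ∈ w, b ≤ x ∧ x ≤ a)) :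
      TypStep (u ++ a :: (w ++ b :: v)) (u ++ a :: b :: v)

/-- `t` results from `s` by exhaustive application of the two operations. -/
def IsTypicalSequenceOf (t s : List ℤ) : Prop :=
  Relation.ReflTransGen TypStep s t ∧ ∀ t', ¬ TypStep t t'

/-- `t` is a typical sequence: the typical sequence of some integer sequence. -/
def IsTypical (t : List ℤ) : Prop := ∃ s : List ℤ, IsTypicalSequenceOf t s

/-! ### The merge matrix and its paths

Rows and columns are counted from `1`. -/

/-- The entry `M[i, j] = r(i) + c(j)` of the merge matrix of `r` and `c`, for
`1 ≤ i ≤ length r` and `1 ≤ j ≤ length c`. -/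
def mergeMatrix (r c : List ℤ) (i j : ℕ) : ℤ := elt r i + elt c j

/-- A step up, to the right, or diagonal. -/
def PathStep (x y : ℕ × ℕ) : Prop :=
  y = (x.1 + 1, x.2) ∨ y = (x.1, x.2 + 1) ∨ y = (x.1 + 1, x.2 + 1)

/-- `p` is a path in an `m × n` matrix. -/
def IsPath (m n : ℕ) (p : List (ℕ × ℕ)) : Prop :=
  (∀ x ∈ p, 1 ≤ x.1 ∧ x.1 ≤ m ∧ 1 ≤ x.2 ∧ x.2 ≤ n) ∧
  p.head? = some (1, 1) ∧ p.getLast? = some (m, n) ∧ p.IsChain PathStep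

/-- The sequence `M[p]` of entries of the merge matrix `M` of `r` and `c` along `p`. -/
def entries (r c : List ℤ) (p : List (ℕ × ℕ)) : List ℤ :=
  p.map fun x => mergeMatrix r c x.1 x.2

/-- `p` is a path in the merge matrix of `r` and `c` that dominates all its paths. -/
def IsDominatingPath (r c : List ℤ) (p : List (ℕ × ℕ)) : Prop :=
  IsPath r.length c.length p ∧
    ∀ q, IsPath r.length c.length q → Dominates (entries r c p) (entries r c q)

/-! ### The Split-and-Chop algorithm

The arguments `i j m n` refer to the submatrix `M[i..m, j..n]` of the merge matrix. -/

/-- `(i, j), (i, j + 1), …, (i, n), (i + 1, n), …, (m, n)`. -/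
def rightUp (i j m n : ℕ) : List (ℕ × ℕ) :=
  (List.range' j (n + 1 - j)).map (fun y => (i, y)) ++
    (List.range' (i + 1) (m - i)).map (fun x => (x, n))

/-- `(i, j), (i + 1, j), …, (m, j), (m, j + 1), …, (m, n)`. -/
def upRight (i j m n : ℕ) : List (ℕ × ℕ) :=
  (List.range' i (m + 1 - i)).map (fun x => (x, j)) ++
    (List.range' (j + 1) (n - j)).map (fun y => (m, y))

/-- Procedure Chop-bottom on `r[1..m]` and `c[1..n]`. -/
def chopBottom (r c : List ℤ) (m n : ℕ) : List (ℕ × ℕ) :=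
  if m ≤ 2 then upRight 1 1 m n
  else if n ≤ 2 then rightUp 1 1 m n
  else if mergeMatrix r c (m - 2) (n - 1) ≤ mergeMatrix r c (m - 1) (n - 2) then
    chopBottom r c (m - 2) n ++ [(m - 1, n), (m, n)]
  else
    chopBottom r c m (n - 2) ++ [(m, n - 1), (m, n)]
termination_by m + n
decreasing_by all_goals omega

/-- Procedure Chop-top on `r[i..m]` and `c[j..n]` (of lengths `m - i + 1` and `n - j + 1`). -/
def chopTop (r c : List ℤ) (i j m n : ℕ) : List (ℕ × ℕ) :=
  if m + 1 ≤ i + 2 then rightUp i j m n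
  else if n + 1 ≤ j + 2 then upRight i j m n
  else if mergeMatrix r c (i + 2) (j + 1) ≤ mergeMatrix r c (i + 1) (j + 2) then
    (i, j) :: (i + 1, j) :: chopTop r c (i + 2) j m n
  else
    (i, j) :: (i, j + 1) :: chopTop r c i (j + 2) m n
termination_by (m - i) + (n - j)
decreasing_by all_goals omega

/-- Split-and-Chop for the choice `i ∈ argmin(r)`, `j ∈ argmin(c)`. The index `(i, j)`, where
the two partial paths meet, is listed once. -/
def splitAndChop (r c : List ℤ) (i j : ℕ) : List (ℕ × ℕ) :=
  chopBottom r c i j ++ (chopTop r c i j r.length c.length).tail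

/-! ### Running time: a random access machine

Unit-cost integer RAM with addition, subtraction, comparison and indirect addressing. -/

/-- Registers, which a program addresses directly, and memory, addressed indirectly. -/
@[ext] structure State where
  reg : ℕ → ℤ
  mem : ℤ → ℤ

def State.setReg (σ : State) (x : ℕ) (v : ℤ) : State :=
  { σ with reg := Function.update σ.reg x v }

def State.setMem (σ : State) (a v : ℤ) : State :=
  { σ with mem := Function.update σ.mem a v }

/-- Programs; `x y z` are names of registers. -/
inductive Program
  /-- `x := k` -/
  | const (x : ℕ) (k : ℤ)
  /-- `x := y + z` -/
  | add (x y z : ℕ)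
  /-- `x := y - z` -/
  | sub (x y z : ℕ)
  /-- `x := mem[y]` -/
  | load (x y : ℕ)
  /-- `mem[x] := y` -/
  | store (x y : ℕ)
  /-- first `P`, then `Q` -/
  | seq (P Q : Program)
  /-- if `x ≤ y` then `P` else `Q` -/
  | branch (x y : ℕ) (P Q : Program)
  /-- while `x ≤ y` do `P` -/
  | loop (x y : ℕ) (P : Program)

/-- `Exec P σ t τ`: started in `σ`, the program `P` halts in `τ` after exactly `t` steps. Every
assignment, memory access and evaluation of a test is one step. -/
inductive Exec : Program → State → ℕ → State → Prop
  | const (σ : State) (x : ℕ) (k : ℤ) :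
      Exec (.const x k) σ 1 (σ.setReg x k)
  | add (σ : State) (x y z : ℕ) :
      Exec (.add x y z) σ 1 (σ.setReg x (σ.reg y + σ.reg z))
  | sub (σ : State) (x y z : ℕ) :
      Exec (.sub x y z) σ 1 (σ.setReg x (σ.reg y - σ.reg z))
  | load (σ : State) (x y : ℕ) :
      Exec (.load x y) σ 1 (σ.setReg x (σ.mem (σ.reg y)))
  | store (σ : State) (x y : ℕ) :
      Exec (.store x y) σ 1 (σ.setMem (σ.reg x) (σ.reg y))
  | seq {P Q : Program} {σ τ υ : State} {t u : ℕ}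
      (hP : Exec P σ t τ) (hQ : Exec Q τ u υ) :
      Exec (.seq P Q) σ (t + u) υ
  | branchTrue {P Q : Program} {σ τ : State} {t x y : ℕ}
      (h : σ.reg x ≤ σ.reg y) (hP : Exec P σ t τ) :
      Exec (.branch x y P Q) σ (1 + t) τ
  | branchFalse {P Q : Program} {σ τ : State} {t x y : ℕ}
      (h : ¬ σ.reg x ≤ σ.reg y) (hQ : Exec Q σ t τ) :
      Exec (.branch x y P Q) σ (1 + t) τ
  | loopTrue {P : Program} {σ τ υ : State} {t u x y : ℕ}
      (h : σ.reg x ≤ σ.reg y) (hP : Exec P σ t τ) (hL : Exec (.loop x y P) τ u υ) :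
      Exec (.loop x y P) σ (1 + t + u) υ
  | loopFalse {P : Program} {σ : State} {x y : ℕ} (h : ¬ σ.reg x ≤ σ.reg y) :
      Exec (.loop x y P) σ 1 σ

/-- Input convention: all registers are `0`; the memory cells `0, 1, 2, …` hold
`m, n, r(1), …, r(m), c(1), …, c(n)`, and all other cells hold `0`. -/
def inputState (r c : List ℤ) : State where
  reg := fun _ => 0
  mem := fun a =>
    if 0 ≤ a then (((r.length : ℤ) :: (c.length : ℤ) :: (r ++ c)).getD a.toNat 0) else 0

/-- Output convention: register `1` holds the length of the path `p`, register `0` holds an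
address `a`, and the cells `a, a + 1, a + 2, …` hold the row and column of `p(1)`, the row
and column of `p(2)`, and so on. -/
def HoldsPath (σ : State) (p : List (ℕ × ℕ)) : Prop :=
  σ.reg 1 = p.length ∧ ∀ h : Fin p.length,
    σ.mem (σ.reg 0 + 2 * (h : ℤ)) = (p.get h).1 ∧
    σ.mem (σ.reg 0 + 2 * (h : ℤ) + 1) = (p.get h).2

/-- On input `r, c`, the program `P` halts after at most `T` steps with output `p`. -/
def OutputsWithin (P : Program) (r c : List ℤ) (T : ℕ) (p : List (ℕ × ℕ)) : Prop :=
  ∃ t τ, t ≤ T ∧ Exec P (inputState r c) t τ ∧ HoldsPath τ p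

end MergeDom

/-! Dominance is handled as `Dom`, a synchronous traversal of two lists that never has the larger
element on the left. It is transitive, compatible with concatenation and reversal, and insensitive
to repeated elements, so paths can be improved piece by piece. The merge matrix is regarded as the
function `A x + B y` on lattice points.

Splitting. Suppose that `A` is minimal at `i` and `B` at `j`, and a path `q` meets row `i` and later
column `j`. The stretch between may be replaced by the corner through `(i, j)`. The largest entry of
the corner is attained in some column of its row part or in some row of its column part; `q` must
cross that column or row, and its entry `p` there is at least as large. Follow row `i` up to the
column of `p`, then rush around the corner to the row of `p` while `q` rests at `p`, and finish
along column `j` (`dom_row_col`). The other order is the mirror image, so it suffices to consider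
paths through `(i, j)` (`exists_dom_through`).

Chopping. In a typical sequence the elements after a minimum alternate: minimum of the rest, maximum
of the rest, and so on (`Irred.zigzag`). At a corner where both sequences are minimal, wait there
until `q` is about to enter the third row. If the test succeeds, the entry of `q` at that moment
bounds everything needed to go two rows up and then along the new row to where `q` enters it
(`exists_dom_two_up`). If the test fails, its mirror image succeeds. Induction gives `dom_chop`; a
point reflection turns Chop-bottom into Chop-top.

Running time. Both halves are generated outwards from the minima. The bottom half is stored at
decreasing addresses and the top half at increasing ones from the same cell, so memory then holds
the whole path in order and nothing has to be reversed or moved. Every round of the loop takes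
constant time and consumes two rows or two columns. -/

namespace MergeDom

/-! ### Dominance by synchronous traversal -/

/-- `s` can be traversed along `t`, never being larger: a recursive form of dominance. -/
inductive Dom : List ℤ → List ℤ → Prop
  | nil : Dom [] []
  | left {a b : ℤ} {s t : List ℤ} (h : a ≤ b) (hd : Dom s (b :: t)) : Dom (a :: s) (b :: t)
  | right {a b : ℤ} {s t : List ℤ} (h : a ≤ b) (hd : Dom (a :: s) t) : Dom (a :: s) (b :: t)
  | both {a b : ℤ} {s t : List ℤ} (h : a ≤ b) (hd : Dom s t) : Dom (a :: s) (b :: t)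

theorem IsExtension.nil : IsExtension [] [] := ⟨[], rfl, .nil⟩

theorem IsExtension.cons {t s : List ℤ} (a : ℤ) (h : IsExtension t s) :
    IsExtension (a :: t) (a :: s) := by
  obtain ⟨bs, rfl, hb⟩ := h
  exact ⟨[a] :: bs, by simp, .cons ⟨by simp, by simp⟩ hb⟩

theorem IsExtension.dup {t s : List ℤ} {a : ℤ} (h : IsExtension t (a :: s)) :
    IsExtension (a :: t) (a :: s) := by
  obtain ⟨bs, rfl, hb⟩ := h
  cases hb with
  | cons h1 h2 =>
    rename_i b bs
    exact ⟨(a :: b) :: bs, by simp, .cons ⟨by simp, by simpa using h1.2⟩ h2⟩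

theorem Dom.dominates {s t : List ℤ} (h : Dom s t) : Dominates s t := by
  induction h with
  | nil => exact ⟨[], [], .nil, .nil, .nil⟩
  | left h _ ih =>
    obtain ⟨r', s', h1, h2, h3⟩ := ih
    exact ⟨_, _, h1.cons _, h2.dup, .cons h h3⟩
  | right h _ ih =>
    obtain ⟨r', s', h1, h2, h3⟩ := ih
    exact ⟨_, _, h1.dup, h2.cons _, .cons h h3⟩
  | both h _ ih =>
    obtain ⟨r', s', h1, h2, h3⟩ := ih
    exact ⟨_, _, h1.cons _, h2.cons _, .cons h h3⟩

theorem Dom.refl (s : List ℤ) : Dom s s := by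
  induction s with
  | nil => exact .nil
  | cons a s ih => exact .both le_rfl ih

/-- The two traversals are run together and synchronised on the middle list. When only the middle
list moves, no step of the composite results; the total length still drops, hence the induction on
it. -/
theorem Dom.trans_aux (N : ℕ) : ∀ {s t u : List ℤ}, s.length + t.length + u.length ≤ N →
    Dom s t → Dom t u → Dom s u := by
  induction N with
  | zero =>
    intro s t u hN h1 h2
    have : s = [] := List.eq_nil_of_length_eq_zero (by omega)
    have : u = [] := List.eq_nil_of_length_eq_zero (by omega)
    subst_vars
    exact .nil
  | succ N ih =>
    intro s t u hN h1 h2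
    cases h1 with
    | nil => exact h2
    | left h hd =>
      have hd2 := h2
      cases h2 with
      | left h' _ | right h' _ | both h' _ =>
        exact .left (h.trans h') (ih (by simp at hN ⊢; omega) hd hd2)
    | right h hd =>
      have h1 := Dom.right h hd
      cases h2 with
      | left h' hd' => exact ih (by simp at hN ⊢; omega) hd hd'
      | right h' hd' => exact .right (h.trans h') (ih (by simp at hN ⊢; omega) h1 hd')
      | both h' hd' => exact .right (h.trans h') (ih (by simp at hN ⊢; omega) hd hd')
    | both h hd =>
      have h1 := Dom.both h hd
      cases h2 with
      | left h' hd' => exact .left (h.trans h') (ih (by simp at hN ⊢; omega) hd hd')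
      | right h' hd' => exact .right (h.trans h') (ih (by simp at hN ⊢; omega) h1 hd')
      | both h' hd' => exact .both (h.trans h') (ih (by simp at hN ⊢; omega) hd hd')

theorem Dom.trans {s t u : List ℤ} (h1 : Dom s t) (h2 : Dom t u) : Dom s u :=
  Dom.trans_aux _ le_rfl h1 h2

theorem Dom.append {s t s' t' : List ℤ} (h : Dom s t) (h' : Dom s' t') :
    Dom (s ++ s') (t ++ t') := by
  induction h with
  | nil => exact h'
  | left h _ ih => exact .left h ih
  | right h _ ih => exact .right h ih
  | both h _ ih => exact .both h ih

theorem Dom.of_forall_le {s : List ℤ} {b : ℤ} (hs : s ≠ []) (h : ∀ a ∈ s, a ≤ b) :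
    Dom s [b] := by
  induction s with
  | nil => exact absurd rfl hs
  | cons a s ih =>
    rcases eq_or_ne s [] with rfl | hne
    · exact .both (h a (by simp)) .nil
    · exact .left (h a (by simp)) (ih hne fun x hx => h x (by simp [hx]))

theorem Dom.of_le_forall {t : List ℤ} {a : ℤ} (ht : t ≠ []) (h : ∀ b ∈ t, a ≤ b) :
    Dom [a] t := by
  induction t with
  | nil => exact absurd rfl ht
  | cons b t ih =>
    rcases eq_or_ne t [] with rfl | hne
    · exact .both (h b (by simp)) .nil
    · exact .right (h b (by simp)) (ih hne fun x hx => h x (by simp [hx]))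

/-- Two traversals can be joined when they share an element of the dominated sequence. -/
theorem Dom.append_shared {s s' t t' : List ℤ} {b : ℤ} (h : Dom s (t ++ [b]))
    (h' : Dom s' (b :: t')) : Dom (s ++ s') (t ++ b :: t') := by
  refine (h.append h').trans ?_
  have hb : Dom [b, b] [b] := .of_forall_le (by simp) (by simp)
  simpa using ((Dom.refl t).append hb).append (Dom.refl t')

/-- The dominated sequence rests at its last element `b` while `w` is traversed. This is the form in
which a path is allowed to rush ahead. -/
theorem Dom.append_le {s w t : List ℤ} {b : ℤ} (h : Dom s (t ++ [b])) (hw : ∀ a ∈ w, a ≤ b) :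
    Dom (s ++ w) (t ++ [b]) := by
  rcases eq_or_ne w [] with rfl | hne
  · simpa using h
  · exact h.append_shared (.of_forall_le hne hw)

/-- Repeating an element gives a dominated sequence. -/
theorem Dom.dup_right (s t : List ℤ) (a : ℤ) : Dom (s ++ a :: t) (s ++ a :: a :: t) := by
  have ha : Dom [a] [a, a] := .of_le_forall (by simp) (by simp)
  simpa using ((Dom.refl s).append ha).append (Dom.refl t)

theorem Dom.reverse {s t : List ℤ} (h : Dom s t) : Dom s.reverse t.reverse := by
  induction h with
  | nil => exact .nil
  | left h _ ih =>
    simp only [List.reverse_cons] at ih ⊢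
    exact ih.append_le (by simpa using h)
  | @right a b s t h _ ih =>
    simp only [List.reverse_cons] at ih ⊢
    -- This traversal visits `a` twice at the end; `Dom.dup_right` removes the repetition.
    have := (ih.append (Dom.both h .nil))
    refine Dom.trans ?_ this
    simpa using Dom.dup_right s.reverse [] a
  | both h _ ih =>
    simp only [List.reverse_cons]
    exact ih.append (.both h .nil)

/-! ### Lattice paths -/

/-- A step up, to the right, or diagonal, in the integer lattice. -/
def LatticeStep (x y : ℤ × ℤ) : Prop :=
  y = (x.1 + 1, x.2) ∨ y = (x.1, x.2 + 1) ∨ y = (x.1 + 1, x.2 + 1)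

/-- `LatticePath s e q`: the list `q` is a lattice path from `s` to `e`. -/
inductive LatticePath : ℤ × ℤ → ℤ × ℤ → List (ℤ × ℤ) → Prop
  | single (p : ℤ × ℤ) : LatticePath p p [p]
  | cons {p p' e : ℤ × ℤ} {q : List (ℤ × ℤ)} (h : LatticeStep p p') (hq : LatticePath p' e q) :
      LatticePath p e (p :: q)

theorem LatticeStep.le {p q : ℤ × ℤ} (h : LatticeStep p q) : p.1 ≤ q.1 ∧ p.2 ≤ q.2 := by
  rcases h with rfl | rfl | rfl <;> simp

theorem LatticeStep.swap {p q : ℤ × ℤ} (h : LatticeStep p q) : LatticeStep p.swap q.swap := by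
  rcases h with rfl | rfl | rfl <;> simp [LatticeStep]

theorem LatticeStep.neg {p q : ℤ × ℤ} (h : LatticeStep p q) : LatticeStep (-q) (-p) := by
  obtain ⟨p1, p2⟩ := p
  rcases h with rfl | rfl | rfl <;> simp [LatticeStep]

namespace LatticePath

theorem bounds {s e : ℤ × ℤ} {q : List (ℤ × ℤ)} (h : LatticePath s e q) :
    (∀ p ∈ q, s.1 ≤ p.1 ∧ p.1 ≤ e.1 ∧ s.2 ≤ p.2 ∧ p.2 ≤ e.2) ∧ s.1 ≤ e.1 ∧ s.2 ≤ e.2 := by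
  induction h with
  | single p => simp
  | cons hs _ ih =>
    have := hs.le
    refine ⟨?_, by omega, by omega⟩
    intro x hx
    rcases List.mem_cons.1 hx with rfl | hx
    · omega
    · have := ih.1 x hx
      omega

theorem append {s e s' e' : ℤ × ℤ} {q q' : List (ℤ × ℤ)} (h : LatticePath s e q)
    (hs : LatticeStep e s') (h' : LatticePath s' e' q') : LatticePath s e' (q ++ q') := by
  induction h with
  | single p => exact .cons hs h'
  | cons hp _ ih => exact .cons hp (ih hs)

theorem append_shared {s p e : ℤ × ℤ} {q q' : List (ℤ × ℤ)} (h : LatticePath s p (q ++ [p]))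
    (h' : LatticePath p e (p :: q')) : LatticePath s e (q ++ p :: q') := by
  cases h' with
  | single => exact h
  | cons hs hq => simpa using h.append hs hq

theorem map_swap {s e : ℤ × ℤ} {q : List (ℤ × ℤ)} (h : LatticePath s e q) :
    LatticePath s.swap e.swap (q.map Prod.swap) := by
  induction h with
  | single p => exact .single _
  | cons hs _ ih => exact .cons hs.swap ih

theorem reverse_neg {s e : ℤ × ℤ} {q : List (ℤ × ℤ)} (h : LatticePath s e q) :
    LatticePath (-e) (-s) (q.map (fun p => -p)).reverse := by
  induction h with
  | single p => exact .single _
  | cons hs _ ih => simpa using ih.append hs.neg (.single _)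

theorem split_at {s e p : ℤ × ℤ} {q : List (ℤ × ℤ)} (h : LatticePath s e q) (hp : p ∈ q) :
    ∃ qa qb, q = qa ++ p :: qb ∧ LatticePath s p (qa ++ [p]) ∧ LatticePath p e (p :: qb) := by
  induction h with
  | single x =>
    obtain rfl : p = x := by simpa using hp
    exact ⟨[], [], rfl, .single _, .single _⟩
  | @cons x x' e q hs hq ih =>
    rcases eq_or_ne p x with rfl | hne
    · exact ⟨[], q, rfl, .single _, .cons hs hq⟩
    · obtain ⟨qa, qb, rfl, h1, h2⟩ := ih (by simpa [hne] using hp)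
      exact ⟨x :: qa, qb, rfl, .cons hs h1, h2⟩

/-- A path meets every row between those of its end points. -/
theorem exists_row {s e : ℤ × ℤ} {q : List (ℤ × ℤ)} (h : LatticePath s e q) {x : ℤ}
    (h1 : s.1 ≤ x) (h2 : x ≤ e.1) : ∃ y, (x, y) ∈ q := by
  induction h with
  | single p =>
    obtain rfl : p.1 = x := by omega
    exact ⟨p.2, by simp⟩
  | @cons p p' e q hs _ ih =>
    rcases eq_or_ne p.1 x with rfl | hne
    · exact ⟨p.2, by simp⟩
    · have : p'.1 ≤ x := by
        rcases hs with rfl | rfl | rfl <;> simp <;> omega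
      obtain ⟨y, hy⟩ := ih this h2
      exact ⟨y, by simp [hy]⟩

theorem exists_col {s e : ℤ × ℤ} {q : List (ℤ × ℤ)} (h : LatticePath s e q) {y : ℤ}
    (h1 : s.2 ≤ y) (h2 : y ≤ e.2) : ∃ x, (x, y) ∈ q := by
  obtain ⟨x, hx⟩ := h.map_swap.exists_row (x := y) h1 h2
  exact ⟨x, by simpa using hx⟩

/-- The first entrance of a path into a row above its first one. -/
theorem exists_enter_row {s e : ℤ × ℤ} {q : List (ℤ × ℤ)} (h : LatticePath s e q) {x : ℤ}
    (h1 : s.1 < x) (h2 : x ≤ e.1) :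
    ∃ qa qb y y', q = qa ++ (x - 1, y) :: (x, y') :: qb ∧
      LatticePath s (x - 1, y) (qa ++ [(x - 1, y)]) ∧ (y' = y ∨ y' = y + 1) ∧
      LatticePath (x, y') e ((x, y') :: qb) := by
  induction h with
  | single p => omega
  | @cons p p' e q hs hq ih =>
    rcases lt_or_ge p'.1 x with hlt | hge
    · obtain ⟨qa, qb, y, y', rfl, h3, h4, h5⟩ := ih hlt h2
      exact ⟨p :: qa, qb, y, y', rfl, .cons hs h3, h4, h5⟩
    · obtain ⟨p1, p2⟩ := p
      obtain ⟨y', hy, rfl⟩ : ∃ y', (y' = p2 ∨ y' = p2 + 1) ∧ p' = (x, y') := by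
        rcases hs with rfl | rfl | rfl
        · exact ⟨p2, by simp, by simp at *; omega⟩
        · simp at *; omega
        · exact ⟨p2 + 1, by simp, by simp at *; omega⟩
      obtain rfl : p1 = x - 1 := by
        have := hs.le
        rcases hs with h | h | h <;> simp at h h1 <;> omega
      cases hq with
      | single => exact ⟨[], [], p2, y', rfl, .single _, hy, .single _⟩
      | cons ha hb => exact ⟨[], _, p2, y', rfl, .single _, hy, .cons ha hb⟩

end LatticePath

/-! ### Values along lattice paths -/

/-- The values `A x + B y` along a list of lattice points `(x, y)`. -/
def vals (A B : ℤ → ℤ) (q : List (ℤ × ℤ)) : List ℤ := q.map fun p => A p.1 + B p.2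

section vals

variable (A B : ℤ → ℤ)

@[simp] theorem vals_nil : vals A B [] = [] := rfl

@[simp] theorem vals_cons (p : ℤ × ℤ) (q : List (ℤ × ℤ)) :
    vals A B (p :: q) = (A p.1 + B p.2) :: vals A B q := rfl

@[simp] theorem vals_append (q q' : List (ℤ × ℤ)) :
    vals A B (q ++ q') = vals A B q ++ vals A B q' := by simp [vals]

theorem vals_swap (q : List (ℤ × ℤ)) : vals B A (q.map Prod.swap) = vals A B q := by
  simp [vals, Function.comp_def, add_comm]

end vals

/-- The `k` points `(x, y), (x + e, y + f), (x + 2 e, y + 2 f), …`. -/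
def seg (x y e f : ℤ) : ℕ → List (ℤ × ℤ)
  | 0 => []
  | k + 1 => (x, y) :: seg (x + e) (y + f) e f k

section seg

variable (x y e f : ℤ)

@[simp] theorem length_seg (k : ℕ) : (seg x y e f k).length = k := by
  induction k generalizing x y with
  | zero => rfl
  | succ k ih => simp [seg, ih]

theorem mem_seg {k : ℕ} {p : ℤ × ℤ} :
    p ∈ seg x y e f k ↔ ∃ t : ℕ, t < k ∧ p = (x + e * t, y + f * t) := by
  induction k generalizing x y with
  | zero => simp [seg]
  | succ k ih =>
    simp only [seg, List.mem_cons, ih]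
    constructor
    · rintro (rfl | ⟨t, ht, rfl⟩)
      · exact ⟨0, by simp, by simp⟩
      · exact ⟨t + 1, by omega, by push_cast; ext <;> simp <;> ring⟩
    · rintro ⟨t, ht, rfl⟩
      cases t with
      | zero => left; simp
      | succ t => exact .inr ⟨t, by omega, by push_cast; ext <;> simp <;> ring⟩

theorem seg_add (k l : ℕ) :
    seg x y e f (k + l) = seg x y e f k ++ seg (x + e * k) (y + f * k) e f l := by
  induction k generalizing x y with
  | zero => simp [seg]
  | succ k ih =>
    rw [Nat.succ_add, seg, ih, seg]
    push_cast
    simp only [List.cons_append]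
    congr 3 <;> ring

theorem seg_succ' (k : ℕ) :
    seg x y e f (k + 1) = seg x y e f k ++ [(x + e * k, y + f * k)] := by
  rw [seg_add]; rfl

theorem map_swap_seg (k : ℕ) : (seg x y e f k).map Prod.swap = seg y x f e k := by
  induction k generalizing x y with
  | zero => rfl
  | succ k ih => simp [seg, ih]

theorem map_neg_seg (k : ℕ) :
    (seg x y e f k).map (fun p => -p) = seg (-x) (-y) (-e) (-f) k := by
  induction k generalizing x y with
  | zero => rfl
  | succ k ih => simp [seg, ih]; congr 1 <;> ring

variable {e f}

theorem LatticePath.seg (h : LatticeStep (0, 0) (e, f)) (k : ℕ) :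
    LatticePath (x, y) (x + e * k, y + f * k) (seg x y e f (k + 1)) := by
  induction k generalizing x y with
  | zero => simpa [MergeDom.seg] using .single _
  | succ k ih =>
    have := ih (x + e) (y + f)
    have hs : LatticeStep (x, y) (x + e, y + f) := by
      simpa [LatticeStep] using h
    have := LatticePath.cons hs this
    rw [MergeDom.seg]
    convert this using 2 <;> push_cast <;> ring

theorem latticeStep_col : LatticeStep (0, 0) (0, 1) := by simp [LatticeStep]

theorem latticeStep_row : LatticeStep (0, 0) (1, 0) := by simp [LatticeStep]

end seg

/-! ### Dominance between lattice paths with common end points -/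

variable {A B : ℤ → ℤ}

/-- A row with minimal `A` dominates all paths between the same columns. -/
theorem dom_row {s e : ℤ × ℤ} {q : List (ℤ × ℤ)} (h : LatticePath s e q) {i : ℤ} {k : ℕ}
    (hk : e.2 = s.2 + k) (hA : ∀ x, s.1 ≤ x → x ≤ e.1 → A i ≤ A x) :
    Dom (vals A B (seg i s.2 0 1 (k + 1))) (vals A B q) := by
  induction h generalizing k with
  | single p =>
    obtain rfl : k = 0 := by omega
    simpa [seg] using Dom.both (by simpa using hA p.1 le_rfl le_rfl) .nil
  | @cons p p' e q hs hq ih =>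
    have hle : A i + B p.2 ≤ A p.1 + B p.2 := by
      have := hA p.1 le_rfl (by have := hs.le; have := hq.bounds; omega)
      omega
    have hA' : ∀ x, p'.1 ≤ x → x ≤ e.1 → A i ≤ A x := fun x h1 h2 =>
      hA x (by have := hs.le; omega) h2
    have hb := hq.bounds.2.2
    -- The row path waits while `q` stays in its column and advances exactly when `q` changes
    -- column.
    rcases eq_or_ne p'.2 p.2 with heq | hne
    · have := ih (k := k) (by omega) hA'
      rw [heq] at this
      exact .right hle this
    · have h1 : p'.2 = p.2 + 1 := by
        rcases hs with rfl | rfl | rfl <;> simp_all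
      obtain ⟨l, rfl⟩ : ∃ l, k = l + 1 := ⟨k - 1, by omega⟩
      have := ih (k := l) (by push_cast at hk; omega) hA'
      rw [h1] at this
      rw [seg]
      simpa using .both hle this

/-- A column with minimal `B` dominates all paths between the same rows. -/
theorem dom_col {s e : ℤ × ℤ} {q : List (ℤ × ℤ)} (h : LatticePath s e q) {j : ℤ} {k : ℕ}
    (hk : e.1 = s.1 + k) (hB : ∀ y, s.2 ≤ y → y ≤ e.2 → B j ≤ B y) :
    Dom (vals A B (seg s.1 j 1 0 (k + 1))) (vals A B q) := by
  have := dom_row (A := B) (B := A) h.map_swap (i := j) (k := k) hk hB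
  rwa [vals_swap, ← map_swap_seg, vals_swap] at this

/-- If `A i` and `B j` are minimal, then going along row `i` and then along column `j`
dominates all paths with the same end points. -/
theorem dom_row_col {i y : ℤ} {k l : ℕ} {q : List (ℤ × ℤ)}
    (h : LatticePath (i, y) (i + l, y + k) q)
    (hA : ∀ x, i ≤ x → x ≤ i + l → A i ≤ A x)
    (hB : ∀ z, y ≤ z → z ≤ y + k → B (y + k) ≤ B z) :
    Dom (vals A B (seg i y 0 1 (k + 1) ++ seg (i + 1) (y + k) 1 0 l)) (vals A B q) := by
  obtain ⟨xm, hxm, hxmax⟩ := Finset.exists_max_image (Finset.Icc i (i + l)) A ⟨i, by simp⟩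
  obtain ⟨ym, hym, hymax⟩ := Finset.exists_max_image (Finset.Icc y (y + k)) B ⟨y, by simp⟩
  simp only [Finset.mem_Icc] at *
  -- A point of `q` whose entry bounds the whole corner path: if the row part has the larger
  -- maximum, take where `q` meets column `ym`, otherwise where it meets row `xm`. Minimality of `A
  -- i` or `B (y + k)` gives the bound.
  obtain ⟨p, hp, hr, hc⟩ : ∃ p ∈ q, (∀ z, y ≤ z → z ≤ y + k → A i + B z ≤ A p.1 + B p.2) ∧
      (∀ x, i ≤ x → x ≤ i + l → A x + B (y + k) ≤ A p.1 + B p.2) := by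
    rcases le_total (A xm + B (y + k)) (A i + B ym) with hle | hle
    · obtain ⟨x', hx'⟩ := h.exists_col hym.1 hym.2
      have hb := h.bounds.1 _ hx'
      have := hA x' hb.1 hb.2.1
      refine ⟨_, hx', fun z h1 h2 => ?_, fun x h1 h2 => ?_⟩
      · have := hymax z ⟨h1, h2⟩
        dsimp only
        omega
      · have := hxmax x ⟨h1, h2⟩
        dsimp only
        omega
    · obtain ⟨y', hy'⟩ := h.exists_row hxm.1 hxm.2
      have hb := h.bounds.1 _ hy'
      have := hB y' hb.2.2.1 hb.2.2.2
      refine ⟨_, hy', fun z h1 h2 => ?_, fun x h1 h2 => ?_⟩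
      · have := hymax z ⟨h1, h2⟩
        dsimp only
        omega
      · have := hxmax x ⟨h1, h2⟩
        dsimp only
        omega
  have hb := h.bounds.1 _ hp
  obtain ⟨qa, qb, rfl, h1, h2⟩ := h.split_at hp
  obtain ⟨px, py⟩ := p
  simp only at hb
  obtain ⟨k', hk'⟩ := Int.le.dest hb.2.2.1
  obtain ⟨l', hl'⟩ := Int.le.dest hb.1
  obtain ⟨k'', rfl⟩ : ∃ k'', k = k' + k'' := ⟨k - k', by omega⟩
  obtain ⟨l'', rfl⟩ : ∃ l'', l = l' + l'' := ⟨l - l', by omega⟩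
  have d1 := dom_row (A := A) (B := B) h1 (i := i) (k := k') (by simp; omega)
    (fun x h1 h2 => hA x h1 (by simp at h2; omega))
  have d2 := dom_col (A := A) (B := B) h2 (j := y + (k' + k'' : ℕ)) (k := l'') (by simp; omega)
    (fun z h1 h2 => hB z (by simp at h1; omega) h2)
  simp only [vals_append, vals_cons, vals_nil] at d1 d2
  have d3 := d1.append_le
    (w := vals A B (seg i (y + k' + 1) 0 1 k'' ++ seg i (y + (k' + k'' : ℕ)) 1 0 l')) (by
      intro a ha
      simp only [vals, List.mem_map, List.mem_append, mem_seg] at ha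
      obtain ⟨z, ⟨t, ht, rfl⟩ | ⟨t, ht, rfl⟩, rfl⟩ := ha
      · simpa using hr (y + k' + 1 + t) (by omega) (by push_cast; omega)
      · simpa using hc (i + t) (by omega) (by push_cast; omega))
  -- Row, rush around the corner with `q` at rest in `p`, column. The corner point occurs twice in
  -- this list, once in `e1` and once in `e2`; the last line merges the copies.
  have d4 := d3.append_shared d2
  have e1 : seg i y 0 1 (k' + 1) ++ seg i (y + k' + 1) 0 1 k'' =
      seg i y 0 1 (k' + k'') ++ [(i, y + (k' + k'' : ℕ))] := by
    rw [show seg i (y + k' + 1) 0 1 k'' = seg (i + 0 * (k' + 1 : ℕ)) (y + 1 * (k' + 1 : ℕ)) 0 1 k''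
      by push_cast; congr 1 <;> ring, ← seg_add, show k' + 1 + k'' = k' + k'' + 1 by ring,
      seg_succ']
    simp
  have e2 : seg i (y + (k' + k'' : ℕ)) 1 0 l' ++ seg px (y + (k' + k'' : ℕ)) 1 0 (l'' + 1) =
      (i, y + (k' + k'' : ℕ)) :: seg (i + 1) (y + (k' + k'' : ℕ)) 1 0 (l' + l'') := by
    rw [show seg px (y + (k' + k'' : ℕ)) 1 0 (l'' + 1) =
      seg (i + 1 * l') (y + (k' + k'' : ℕ) + 0 * l') 1 0 (l'' + 1) by congr 1 <;> omega,
      ← seg_add, ← add_assoc, seg]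
    simp
  rw [seg_succ', vals_append, vals_append, vals_cons]
  rw [vals_append, vals_cons]
  refine Dom.trans ?_ d4
  rw [← vals_append, ← vals_append, ← List.append_assoc, e1, List.append_assoc _ _ (seg px _ 1 0 _),
    e2]
  simpa using Dom.dup_right (vals A B (seg i y 0 1 (k' + k''))) _ _

/-- Because `q` is in row `i` no later than column `j`, it meets column `j` afterwards, in some row
`x₁ ≥ i`. The part between these two points is replaced by the corner path of `dom_row_col`, whose
corner is `(i, j)`. -/
theorem exists_dom_through_aux {x₀ y₀ m n i j y₁ : ℤ} {q : List (ℤ × ℤ)}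
    (h : LatticePath (x₀, y₀) (m, n) q) (hy : (i, y₁) ∈ q) (hyj : y₁ ≤ j) (hj : j ≤ n)
    (hA : ∀ x, x₀ ≤ x → x ≤ m → A i ≤ A x) (hB : ∀ y, y₀ ≤ y → y ≤ n → B j ≤ B y) :
    ∃ q₁ q₂, LatticePath (x₀, y₀) (i, j) (q₁ ++ [(i, j)]) ∧
      LatticePath (i, j) (m, n) ((i, j) :: q₂) ∧
      Dom (vals A B (q₁ ++ (i, j) :: q₂)) (vals A B q) := by
  have hb := h.bounds.1 _ hy
  obtain ⟨qa, qb, rfl, h1, h2⟩ := h.split_at hy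
  obtain ⟨x₁, hx₁⟩ := h2.exists_col hyj hj
  have hb' := h2.bounds.1 _ hx₁
  obtain ⟨qc, qd, hq, h3, h4⟩ := h2.split_at hx₁
  simp only at hb hb'
  obtain ⟨k, rfl⟩ := Int.le.dest hb'.2.2.1
  obtain ⟨l, rfl⟩ := Int.le.dest hb'.1
  have d := dom_row_col (A := A) (B := B) h3 (fun x h1 h2 => hA x (by omega) (by omega))
    (fun y h1 h2 => hB y (by omega) (by omega))
  have p1 := LatticePath.seg i y₁ latticeStep_col k
  have p2 := LatticePath.seg i (y₁ + k) latticeStep_row l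
  rw [seg_succ'] at p1 p2
  simp only [zero_mul, one_mul, add_zero] at p1 p2
  refine ⟨qa ++ seg i y₁ 0 1 k, seg (i + 1) (y₁ + k) 1 0 l ++ qd, ?_, ?_, ?_⟩
  · cases k with
    | zero => simpa [seg] using h1
    | succ k =>
      rw [seg] at p1 ⊢
      simpa using h1.append_shared p1
  · have := p2.append_shared h4
    have e : seg i (y₁ + k) 1 0 l ++ [(i + l, y₁ + k)] =
        (i, y₁ + k) :: seg (i + 1) (y₁ + k) 1 0 l := by
      have := seg_succ' i (y₁ + k) 1 0 l
      simpa [seg] using this.symm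
    rw [← List.cons_append, ← e]
    simpa using this
  · rw [hq]
    rw [seg_succ'] at d
    have := ((Dom.refl (vals A B qa)).append d).append (Dom.refl (vals A B qd))
    simpa using this

/-- Every path is dominated by one through the point at which `A` and `B` are minimal. -/
theorem exists_dom_through {x₀ y₀ m n i j : ℤ} {q : List (ℤ × ℤ)}
    (h : LatticePath (x₀, y₀) (m, n) q) (hi : x₀ ≤ i) (him : i ≤ m) (hj : y₀ ≤ j) (hjn : j ≤ n)
    (hA : ∀ x, x₀ ≤ x → x ≤ m → A i ≤ A x) (hB : ∀ y, y₀ ≤ y → y ≤ n → B j ≤ B y) :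
    ∃ q₁ q₂, LatticePath (x₀, y₀) (i, j) (q₁ ++ [(i, j)]) ∧
      LatticePath (i, j) (m, n) ((i, j) :: q₂) ∧
      Dom (vals A B (q₁ ++ (i, j) :: q₂)) (vals A B q) := by
  obtain ⟨y₁, hy₁⟩ := h.exists_row hi him
  rcases le_total y₁ j with hle | hle
  · exact exists_dom_through_aux h hy₁ hle hjn hA hB
  -- Here `q` meets column `j` on its way to row `i`, so the auxiliary lemma applies with rows and
  -- columns exchanged.
  · obtain ⟨qa, qb, rfl, h1, h2⟩ := h.split_at hy₁
    obtain ⟨x₁, hx₁⟩ := h1.exists_col hj hle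
    have hb := h1.bounds.1 _ hx₁
    have hmem : (j, x₁) ∈ (qa ++ (i, y₁) :: qb).map Prod.swap := by
      simp only [List.mem_map]
      refine ⟨(x₁, j), ?_, rfl⟩
      simp only [List.mem_append, List.mem_cons, List.not_mem_nil, or_false] at hx₁ ⊢
      tauto
    obtain ⟨q₁, q₂, g1, g2, g3⟩ :=
      exists_dom_through_aux (A := B) (B := A) h.map_swap hmem hb.2.1 him hB hA
    refine ⟨q₁.map Prod.swap, q₂.map Prod.swap, by simpa using g1.map_swap,
      by simpa using g2.map_swap, ?_⟩
    rw [vals_swap] at g3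
    convert g3 using 1
    rw [← vals_swap]
    simp [Function.comp_def]

/-- If `A (x + 2)` and `B (y + 2)` are minimal and `A (x + 1)` and `B (y + 1)` are maximal from
there on, and the test of the algorithm succeeds, then paths may be assumed to begin with two
steps up. -/
theorem exists_dom_two_up {x y m n : ℤ} {q : List (ℤ × ℤ)} (h : LatticePath (x, y) (m, n) q)
    (hm : x + 2 ≤ m)
    (hA0 : ∀ x', x ≤ x' → x' ≤ m → A x ≤ A x')
    (hA1 : A (x + 2) ≤ A (x + 1))
    (hB0 : ∀ y', y ≤ y' → y' ≤ n → B y ≤ B y')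
    (hB1 : ∀ y', y ≤ y' → y' ≤ n → B y' ≤ B (y + 1))
    (hB2 : ∀ y', y + 1 ≤ y' → y' ≤ n → B (y + 2) ≤ B y')
    (htest : A (x + 2) + B (y + 1) ≤ A (x + 1) + B (y + 2)) :
    ∃ q', LatticePath (x + 2, y) (m, n) q' ∧
      Dom (vals A B ((x, y) :: (x + 1, y) :: q')) (vals A B q) := by
  have hb0 := h.bounds
  -- `q` leaves row `x + 1` in column `z` and enters row `x + 2` in column `z'`, which is `z` or `z
  -- + 1`. The new path goes up in column `y` and along row `x + 2` to column `z'`, then follows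
  -- `q`.
  obtain ⟨qa, qb, z, z', rfl, h1, h2, h3⟩ := h.exists_enter_row (x := x + 2) (by simp) hm
  rw [show x + 2 - 1 = x + 1 by ring] at h1 ⊢
  have hz := h1.bounds.2.2
  have hz' := h3.bounds.2.2
  simp only at hz hz'
  obtain ⟨k, rfl⟩ := Int.le.dest (show y ≤ z' by omega)
  refine ⟨seg (x + 2) y 0 1 k ++ (x + 2, y + k) :: qb, ?_, ?_⟩
  · have := LatticePath.seg (x + 2) y latticeStep_col k
    rw [seg_succ'] at this
    simp only [zero_mul, one_mul, add_zero] at this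
    exact this.append_shared h3
  · have d1 : Dom [A x + B y] (vals A B (qa ++ [(x + 1, z)])) := by
      refine .of_le_forall (by simp) ?_
      intro b hb
      simp only [vals, List.mem_map] at hb
      obtain ⟨p, hp, rfl⟩ := hb
      have hpb := h1.bounds.1 p hp
      simp only at hpb
      have := hA0 p.1 (by omega) (by omega)
      have := hB0 p.2 (by omega) (by omega)
      omega
    rw [vals_append] at d1
    have d2 := Dom.append_le (w := vals A B ((x + 1, y) :: seg (x + 2) y 0 1 k)) d1 (by
      intro a ha
      -- If `z = y`, then `k ≤ 1` and only `t = y` occurs, where `hA1` suffices. Otherwise `B t ≤ B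
      -- (y + 1)` and `B (y + 2) ≤ B z`, which reduces the claim to the test.
      have key : ∀ t : ℤ, y ≤ t → t < y + k → A (x + 2) + B t ≤ A (x + 1) + B z := by
        intro t ht ht'
        rcases eq_or_ne z y with rfl | hne
        · obtain rfl : t = z := by omega
          omega
        · have := hB2 z (by omega) (by omega)
          have := hB1 t (by omega) (by omega)
          omega
      simp only [vals, List.mem_map, List.mem_cons, mem_seg] at ha
      obtain ⟨p, rfl | ⟨t, ht, rfl⟩, rfl⟩ := ha
      · have := hB0 z (by omega) (by omega)
        dsimp only
        omega
      · simpa using key (y + t) (by omega) (by omega))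
    have d3 := d2.append (Dom.refl (vals A B ((x + 2, y + k) :: qb)))
    simpa using d3

/-! ### The chop procedure, outwards from a minimum, in direction `d` -/

/-- The path of `chopTop` (for `d = 1`) and, in reverse order, of `chopBottom` (for `d = -1`),
from `(x, y)` on, through `u` rows and `v` columns. -/
def chop (A B : ℤ → ℤ) (d x y : ℤ) (u v : ℕ) : List (ℤ × ℤ) :=
  if u ≤ 2 then seg x y 0 d (v - 1) ++ seg x (y + d * (v - 1 : ℕ)) d 0 u
  else if v ≤ 2 then seg x y d 0 (u - 1) ++ seg (x + d * (u - 1 : ℕ)) y 0 d v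
  else if A (x + 2 * d) + B (y + d) ≤ A (x + d) + B (y + 2 * d) then
    seg x y d 0 2 ++ chop A B d (x + 2 * d) y (u - 2) v
  else
    seg x y 0 d 2 ++ chop A B d x (y + 2 * d) u (v - 2)
termination_by u + v
decreasing_by all_goals omega

/-- Point reflection reverses the direction of the procedure and keeps the outcome of every test.
Through it all statements about Chop-bottom follow from those about Chop-top. -/
theorem map_neg_chop (A B : ℤ → ℤ) (d x y : ℤ) (u v : ℕ) :
    (chop A B d x y u v).map (fun p => -p) =
      chop (fun z => A (-z)) (fun z => B (-z)) (-d) (-x) (-y) u v := by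
  induction x, y, u, v using chop.induct A B d with
  | case1 x y u v hu =>
    rw [chop.eq_1 A B d x y u v, chop.eq_1 (fun z => A (-z)) _ (-d) (-x) (-y) u v, if_pos hu, if_pos hu, List.map_append, map_neg_seg, map_neg_seg]
    congr 2
    all_goals ring
  | case2 x y u v hu hv =>
    rw [chop.eq_1 A B d x y u v, chop.eq_1 (fun z => A (-z)) _ (-d) (-x) (-y) u v, if_neg hu, if_neg hu, if_pos hv, if_pos hv, List.map_append, map_neg_seg,
      map_neg_seg]
    congr 2
    all_goals ring
  | case3 x y u v hu hv ht ih =>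
    rw [chop.eq_1 A B d x y u v, chop.eq_1 (fun z => A (-z)) _ (-d) (-x) (-y) u v,
      if_neg hu, if_neg hu, if_neg hv, if_neg hv, if_pos ht, if_pos,
      List.map_append, map_neg_seg, ih]
    · congr 2
      all_goals ring
    · convert ht using 3 <;> ring
  | case4 x y u v hu hv ht ih =>
    rw [chop.eq_1 A B d x y u v, chop.eq_1 (fun z => A (-z)) _ (-d) (-x) (-y) u v,
      if_neg hu, if_neg hu, if_neg hv, if_neg hv, if_neg ht, if_neg,
      List.map_append, map_neg_seg, ih]
    · congr 2
      all_goals ring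
    · convert ht using 4 <;> ring

/-- From `x` on, through `u` positions, `A` is alternatingly a minimum and a maximum of the
remaining part, apart possibly from the last positions. -/
def Zigzag (A : ℤ → ℤ) (x : ℤ) (u : ℕ) : Prop :=
  ∀ s : ℕ, 2 * s < u → (∀ k : ℕ, 2 * s ≤ k → k < u → A (x + 2 * s) ≤ A (x + k)) ∧
    (2 * s + 2 < u → ∀ k : ℕ, 2 * s ≤ k → k < u → A (x + k) ≤ A (x + 2 * s + 1))

section Zigzag

variable {A B : ℤ → ℤ} {x : ℤ} {u : ℕ}

theorem Zigzag.drop_two (h : Zigzag A x u) : Zigzag A (x + 2) (u - 2) := by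
  intro s hs
  obtain ⟨h1, h2⟩ := h (s + 1) (by omega)
  refine ⟨fun k hk hku => ?_, fun h3 k hk hku => ?_⟩
  · convert h1 (k + 2) (by omega) (by omega) using 2 <;> push_cast <;> ring
  · convert h2 (by omega) (k + 2) (by omega) (by omega) using 2 <;> push_cast <;> ring

theorem Zigzag.min (h : Zigzag A x u) {z : ℤ} (h1 : x ≤ z) (h2 : z < x + u) : A x ≤ A z := by
  obtain ⟨k, rfl⟩ := Int.le.dest h1
  simpa using (h 0 (by omega)).1 k (by omega) (by omega)

theorem Zigzag.max (h : Zigzag A x u) (hu : 2 < u) {z : ℤ} (h1 : x ≤ z) (h2 : z < x + u) :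
    A z ≤ A (x + 1) := by
  obtain ⟨k, rfl⟩ := Int.le.dest h1
  simpa using (h 0 (by omega)).2 (by omega) k (by omega) (by omega)

theorem Zigzag.min_two (h : Zigzag A x u) (hu : 2 < u) {z : ℤ} (h1 : x + 1 ≤ z)
    (h2 : z < x + u) : A (x + 2) ≤ A z := by
  rcases eq_or_ne z (x + 1) with rfl | hne
  · exact h.max hu (by omega) (by omega)
  · exact h.drop_two.min (by omega) (by omega)

end Zigzag

theorem LatticePath.exists_eq_append {s e : ℤ × ℤ} {q : List (ℤ × ℤ)} (h : LatticePath s e q) :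
    ∃ q', q = q' ++ [e] := by
  induction h with
  | single p => exact ⟨[], rfl⟩
  | cons _ _ ih =>
    obtain ⟨q', rfl⟩ := ih
    exact ⟨_ :: q', rfl⟩

theorem LatticePath.exists_eq_cons {s e : ℤ × ℤ} {q : List (ℤ × ℤ)} (h : LatticePath s e q) :
    ∃ q', q = s :: q' := by
  cases h <;> simp

theorem latticePath_right_up (x y : ℤ) (k l : ℕ) :
    LatticePath (x, y) (x + l, y + k) (seg x y 0 1 k ++ seg x (y + k) 1 0 (l + 1)) := by
  have h1 := LatticePath.seg x y latticeStep_col k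
  have h2 := LatticePath.seg x (y + k) latticeStep_row l
  rw [seg_succ'] at h1
  rw [MergeDom.seg] at h2 ⊢
  simp only [zero_mul, one_mul, add_zero] at h1 h2 ⊢
  exact h1.append_shared h2

/-! ### Correctness of the chop procedure -/

section chop

variable {A B : ℤ → ℤ}

/-- The base case with at most two rows. The minimal row dominates `q` by `dom_row`; a final step
up, if there is one, is made while `q` rests at its end, which is the very point reached. -/
theorem dom_right_up {x y : ℤ} {k l : ℕ} (hl : l ≤ 1) {q : List (ℤ × ℤ)}
    (h : LatticePath (x, y) (x + l, y + k) q) (hA : ∀ z, x ≤ z → z ≤ x + l → A x ≤ A z) :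
    Dom (vals A B (seg x y 0 1 k ++ seg x (y + k) 1 0 (l + 1))) (vals A B q) := by
  have d := dom_row (A := A) (B := B) h (i := x) (k := k) rfl hA
  obtain ⟨q', rfl⟩ := h.exists_eq_append
  have e : seg x y 0 1 (k + 1) = seg x y 0 1 k ++ [(x, y + k)] := by simp [seg_succ']
  simp only [vals_append, vals_cons, vals_nil] at d
  have := d.append_le (w := vals A B (seg (x + 1) (y + k) 1 0 l)) (by
    intro a ha
    simp only [vals, List.mem_map, mem_seg] at ha
    obtain ⟨_, ⟨t, ht, rfl⟩, rfl⟩ := ha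
    obtain rfl : l = 1 := by omega
    obtain rfl : t = 0 := by omega
    simp)
  simp only [e] at this
  simpa [seg] using this

theorem latticePath_chop {x y : ℤ} {u v : ℕ} (hu : 1 ≤ u) (hv : 1 ≤ v) :
    LatticePath (x, y) (x + (u - 1 : ℕ), y + (v - 1 : ℕ)) (chop A B 1 x y u v) := by
  induction hN : u + v using Nat.strong_induction_on generalizing x y u v with
  | _ N ih =>
    rw [chop]
    split_ifs with h1 h2 h3
    · simpa [Nat.sub_add_cancel hu] using latticePath_right_up x y (v - 1) (u - 1)
    · have := (latticePath_right_up y x (u - 1) (v - 1)).map_swap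
      simpa [Nat.sub_add_cancel hv, map_swap_seg] using this
    · have := ih _ (by omega) (x := x + 2 * 1) (y := y) (u := u - 2) (v := v) (by omega) (by omega) rfl
      rw [show x + 2 * 1 + (u - 2 - 1 : ℕ) = x + (u - 1 : ℕ) by omega] at this
      refine .cons (.inl (show (x + 1, y + 0) = _ by simp)) (.cons (.inl ?_) this)
      ext <;> simp; ring
    · have := ih _ (by omega) (x := x) (y := y + 2 * 1) (u := u) (v := v - 2) (by omega) (by omega) rfl
      rw [show y + 2 * 1 + (v - 2 - 1 : ℕ) = y + (v - 1 : ℕ) by omega] at this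
      refine .cons (.inr (.inl (show (x + 0, y + 1) = _ by simp))) (.cons (.inr (.inl ?_)) this)
      ext <;> simp; ring

/-- The chop procedure dominates all paths. -/
theorem dom_chop {x y : ℤ} {u v : ℕ} (hu : 1 ≤ u) (hv : 1 ≤ v) (hA : Zigzag A x u)
    (hB : Zigzag B y v) {q : List (ℤ × ℤ)}
    (h : LatticePath (x, y) (x + (u - 1 : ℕ), y + (v - 1 : ℕ)) q) :
    Dom (vals A B (chop A B 1 x y u v)) (vals A B q) := by
  induction hN : u + v using Nat.strong_induction_on generalizing x y u v q with
  | _ N ih =>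
    rw [chop]
    split_ifs with h1 h2 h3
    · have := dom_right_up (A := A) (B := B) (by omega) h
        (fun z hz hz' => hA.min hz (by omega))
      simpa [Nat.sub_add_cancel hu] using this
    · have := dom_right_up (A := B) (B := A) (by omega) h.map_swap
        (fun z hz hz' => hB.min hz (by omega))
      rw [vals_swap, ← vals_swap] at this
      simpa [Nat.sub_add_cancel hv, map_swap_seg] using this
    · obtain ⟨q', g1, g2⟩ := exists_dom_two_up (A := A) (B := B) h (by omega)
        (fun z _ _ => hA.min (by omega) (by omega)) (hA.max (by omega) (by omega) (by omega))
        (fun z _ _ => hB.min (by omega) (by omega))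
        (fun z _ _ => hB.max (by omega) (by omega) (by omega))
        (fun z _ _ => hB.min_two (by omega) (by omega) (by omega)) (by simpa using h3)
      have := ih _ (by omega) (u := u - 2) (v := v) (by omega) hv hA.drop_two hB (q := q')
        (by convert g1 using 2; omega) rfl
      refine Dom.trans ?_ g2
      simpa [seg] using (Dom.refl (vals A B [(x, y), (x + 1, y)])).append this
    -- Failure of the test is more than success of its mirror image, so two steps to the right are
    -- justified by the same lemma with rows and columns exchanged.
    · have h3' : B (y + 2) + A (x + 1) ≤ B (y + 1) + A (x + 2) := by
        simp only [mul_one] at h3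
        omega
      obtain ⟨q', g1, g2⟩ := exists_dom_two_up (A := B) (B := A) h.map_swap
        (show y + 2 ≤ y + (v - 1 : ℕ) by omega)
        (fun z _ _ => hB.min (by omega) (by omega)) (hB.max (by omega) (by omega) (by omega))
        (fun z _ _ => hA.min (by omega) (by omega))
        (fun z _ _ => hA.max (by omega) (by omega) (by omega))
        (fun z _ _ => hA.min_two (by omega) (by omega) (by omega)) h3'
      have g1' := g1.map_swap
      simp only [Prod.swap_prod_mk] at g1'
      rw [show y + (v - 1 : ℕ) = y + 2 + (v - 2 - 1 : ℕ) by omega] at g1'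
      have := ih _ (by omega) (u := u) (v := v - 2) hu (by omega) hA hB.drop_two
        (q := q'.map Prod.swap) g1' rfl
      rw [vals_swap] at g2
      rw [vals_swap B A] at this
      refine Dom.trans ?_ g2
      have := (Dom.refl (vals B A [(y, x), (y + 1, x)])).append this
      simpa [seg, add_comm (B _) (A _)] using this

theorem vals_map_neg (q : List (ℤ × ℤ)) :
    vals A B (q.map fun p => -p) = vals (fun z => A (-z)) (fun z => B (-z)) q := by
  simp [vals, Function.comp_def]

theorem latticePath_reverse_chop {x y : ℤ} {u v : ℕ} (hu : 1 ≤ u) (hv : 1 ≤ v) :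
    LatticePath (x - (u - 1 : ℕ), y - (v - 1 : ℕ)) (x, y) (chop A B (-1) x y u v).reverse := by
  have := (latticePath_chop (A := fun z => A (-z)) (B := fun z => B (-z)) (x := -x) (y := -y)
    hu hv).reverse_neg
  rw [map_neg_chop] at this
  simpa [sub_eq_neg_add] using this

/-- The path `q` is reflected and read backwards, `dom_chop` is applied, and `Dom.reverse` carries
the traversal back. -/
theorem dom_reverse_chop {x y : ℤ} {u v : ℕ} (hu : 1 ≤ u) (hv : 1 ≤ v)
    (hA : Zigzag (fun z => A (-z)) (-x) u) (hB : Zigzag (fun z => B (-z)) (-y) v)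
    {q : List (ℤ × ℤ)} (h : LatticePath (x - (u - 1 : ℕ), y - (v - 1 : ℕ)) (x, y) q) :
    Dom (vals A B (chop A B (-1) x y u v).reverse) (vals A B q) := by
  have d := dom_chop hu hv hA hB (q := (q.map fun p => -p).reverse)
    (by simpa [sub_eq_neg_add] using h.reverse_neg)
  have d' := d.reverse
  rw [← vals_map_neg, ← vals_map_neg, map_neg_chop] at d'
  simpa [vals, Function.comp_def] using d'

end chop

/-! ### Irreducible sequences -/

/-- On `[lo, hi]` none of the two operations on sequences is applicable to `A`. -/
def Irred (A : ℤ → ℤ) (lo hi : ℤ) : Prop :=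
  (∀ x, lo ≤ x → x < hi → A x ≠ A (x + 1)) ∧
  ∀ x y, lo ≤ x → x + 2 ≤ y → y ≤ hi →
    ¬ (∀ z, x < z → z < y → A x ≤ A z ∧ A z ≤ A y) ∧
    ¬ (∀ z, x < z → z < y → A y ≤ A z ∧ A z ≤ A x)

theorem Irred.mono {A : ℤ → ℤ} {lo hi lo' hi' : ℤ} (h : Irred A lo hi) (h1 : lo ≤ lo')
    (h2 : hi' ≤ hi) : Irred A lo' hi' :=
  ⟨fun x hx hx' => h.1 x (by omega) (by omega),
    fun x y hx hxy hy => h.2 x y (by omega) hxy (by omega)⟩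

theorem Irred.neg {A : ℤ → ℤ} {lo hi : ℤ} (h : Irred A lo hi) :
    Irred (fun z => A (-z)) (-hi) (-lo) := by
  refine ⟨fun x hx hx' heq => h.1 (-x - 1) (by omega) (by omega) ?_, fun x y hx hxy hy => ?_⟩
  · rw [show -x - 1 + 1 = -x by ring, show -x - 1 = -(x + 1) by ring]
    exact heq.symm
  · have := h.2 (-y) (-x) (by omega) (by omega) (by omega)
    refine ⟨fun h' => this.2 fun z h1 h2 => ?_, fun h' => this.1 fun z h1 h2 => ?_⟩
    · simpa using h' (-z) (by omega) (by omega)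
    · simpa using h' (-z) (by omega) (by omega)

/-- Let `p` be a minimum of the remaining part and `w` a maximum of it. Were `w ≥ p + 2`, everything
between could be removed by a typical operation; were `w = p`, then `A p = A (p + 1)` would be a
repetition. So `w = p + 1`, and by the same argument upside down the minimum from `p + 1` on is at
`p + 2`. -/
theorem Irred.zigzag {A : ℤ → ℤ} {x : ℤ} {u : ℕ} (h : Irred A x (x + u - 1))
    (hmin : ∀ z, x ≤ z → z < x + u → A x ≤ A z) : Zigzag A x u := by
  have hmax : ∀ p : ℤ, x ≤ p → p + 2 < x + u → (∀ z, p ≤ z → z < x + u → A p ≤ A z) →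
      ∀ z, p ≤ z → z < x + u → A z ≤ A (p + 1) := by
    intro p hp hpu hpmin
    obtain ⟨w, hw, hwmax⟩ := Finset.exists_max_image (Finset.Ico p (x + u)) A
      ⟨p, by simp; omega⟩
    simp only [Finset.mem_Ico] at hw hwmax
    have h1 : w < p + 2 := by
      by_contra! hlt
      exact (h.2 p w hp hlt (by omega)).1 fun z hz hz' =>
        ⟨hpmin z (by omega) (by omega), hwmax z ⟨by omega, by omega⟩⟩
    have h2 : w ≠ p := by
      rintro rfl
      exact h.1 w hp (by omega) (le_antisymm (hpmin _ (by omega) (by omega))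
        (hwmax _ ⟨by omega, by omega⟩))
    obtain rfl : w = p + 1 := by omega
    exact fun z hz hz' => hwmax z ⟨hz, hz'⟩
  have hmin2 : ∀ p : ℤ, x ≤ p → p + 2 < x + u → (∀ z, p ≤ z → z < x + u → A p ≤ A z) →
      ∀ z, p + 1 ≤ z → z < x + u → A (p + 2) ≤ A z := by
    intro p hp hpu hpmin
    have hm := hmax p hp hpu hpmin
    obtain ⟨w, hw, hwmin⟩ := Finset.exists_min_image (Finset.Ico (p + 1) (x + u)) A
      ⟨p + 1, by simp; omega⟩
    simp only [Finset.mem_Ico] at hw hwmin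
    have h1 : w < p + 3 := by
      by_contra! hlt
      exact (h.2 (p + 1) w (by omega) (by omega) (by omega)).2 fun z hz hz' =>
        ⟨hwmin z ⟨by omega, by omega⟩, hm z (by omega) (by omega)⟩
    have h2 : w ≠ p + 1 := by
      rintro rfl
      exact h.1 (p + 1) (by omega) (by omega) (le_antisymm (hwmin _ ⟨by omega, by omega⟩)
        (hm _ (by omega) (by omega)))
    obtain rfl : w = p + 2 := by omega
    exact fun z hz hz' => hwmin z ⟨hz, hz'⟩
  have key : ∀ s : ℕ, 2 * s < u →
      ∀ z, x + 2 * s ≤ z → z < x + u → A (x + 2 * s) ≤ A z := by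
    intro s
    induction s with
    | zero => simpa using fun _ => hmin
    | succ s ih =>
      intro hs z hz hz'
      have := hmin2 (x + 2 * s) (by omega) (by omega) (ih (by omega)) z
        (by push_cast at hz; omega) hz'
      convert this using 2
      push_cast
      ring
  intro s hs
  exact ⟨fun k hk hku => key s hs _ (by omega) (by omega),
    fun hs' k hk hku => hmax _ (by omega) (by omega) (key s hs) _ (by omega) (by omega)⟩

/-- The elements of a sequence, indexed by integers. -/
def eltZ (s : List ℤ) (z : ℤ) : ℤ := elt s z.toNat

@[simp] theorem eltZ_natCast (s : List ℤ) (k : ℕ) : eltZ s k = elt s k := by simp [eltZ]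

theorem elt_eq_getElem {s : List ℤ} {k : ℕ} (h1 : 1 ≤ k) (h : k ≤ s.length) :
    elt s k = s[k - 1] := by
  rw [elt, List.getD_eq_getElem]

/-- Only exhaustion matters: any violation at positions `x` and `y`, after cutting `s` there with
`take` and `drop`, would be an applicable `TypStep`. -/
theorem IsTypical.irred {s : List ℤ} (h : IsTypical s) : Irred (eltZ s) 1 s.length := by
  obtain ⟨s₀, -, hs⟩ := h
  refine ⟨fun x hx hx' heq => ?_, fun x y hx hxy hy => ?_⟩
  · lift x to ℕ using by omega
    norm_cast at hx hx' heq
    simp only [eltZ_natCast] at heq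
    rw [elt_eq_getElem hx (by omega), elt_eq_getElem (by omega) (by omega)] at heq
    refine hs (s.take (x - 1) ++ s[x - 1] :: s.drop (x + 1)) ?_
    have e : s = s.take (x - 1) ++ s[x - 1] :: s[x - 1] :: s.drop (x + 1) := by
      conv_lhs => rw [← List.take_append_drop (x - 1) s, List.drop_eq_getElem_cons (by omega)]
      congr 2
      rw [List.drop_eq_getElem_cons (by omega), heq]
      congr 2
      · omega
      · omega
    have := TypStep.removeRepetition (s.take (x - 1)) (s.drop (x + 1)) s[x - 1]
    rwa [← e] at this
  · lift x to ℕ using by omega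
    lift y to ℕ using by omega
    norm_cast at hx hxy hy
    set w := (s.drop x).take (y - 1 - x) with hw
    have e : s = s.take (x - 1) ++ s[x - 1] :: (w ++ s[y - 1] :: s.drop y) := by
      conv_lhs => rw [← List.take_append_drop (x - 1) s, List.drop_eq_getElem_cons (by omega)]
      congr 2
      rw [show x - 1 + 1 = x by omega]
      conv_lhs => rw [← List.take_append_drop (y - 1 - x) (s.drop x), List.drop_drop,
        show x + (y - 1 - x) = y - 1 by omega,
        List.drop_eq_getElem_cons (show y - 1 < s.length by omega), show y - 1 + 1 = y by omega]
    have hlen : w.length = y - 1 - x := by simp [hw]; omega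
    have hmem : ∀ a ∈ w, ∃ z : ℤ, x < z ∧ z < y ∧ a = eltZ s z := by
      intro a ha
      obtain ⟨t, ht, rfl⟩ := List.getElem_of_mem ha
      refine ⟨(x + 1 + t : ℕ), by push_cast; omega, by push_cast; omega, ?_⟩
      rw [eltZ_natCast, elt_eq_getElem (by omega) (by omega)]
      simp only [hw, List.getElem_take, List.getElem_drop]
      congr 1
      omega
    have hstep := TypStep.typicalOp (s.take (x - 1)) w (s.drop y) s[x - 1] s[y - 1]
      (by rw [← List.length_pos_iff]; omega)
    rw [← e] at hstep
    simp only [eltZ_natCast, elt_eq_getElem hx (show x ≤ s.length by omega),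
      elt_eq_getElem (show 1 ≤ y by omega) hy]
    refine ⟨fun h => hs _ (hstep (.inl ?_)), fun h => hs _ (hstep (.inr ?_))⟩
    all_goals
      intro a ha
      obtain ⟨z, h1, h2, rfl⟩ := hmem a ha
      exact h z h1 h2

/-! ### Paths and procedures in integer coordinates -/

/-- A pair of indices as a lattice point. -/
def toLattice (p : ℕ × ℕ) : ℤ × ℤ := (p.1, p.2)

theorem toLattice_injective : Function.Injective toLattice := by
  intro p q h
  simp only [toLattice, Prod.mk.injEq, Nat.cast_inj] at h
  exact Prod.ext h.1 h.2

theorem latticePath_iff {s e : ℤ × ℤ} {q : List (ℤ × ℤ)} :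
    LatticePath s e q ↔ q.head? = some s ∧ q.getLast? = some e ∧ q.IsChain LatticeStep := by
  constructor
  · intro h
    induction h with
    | single p => simp
    | cons hs hq ih =>
      obtain ⟨q', rfl⟩ := hq.exists_eq_cons
      refine ⟨rfl, ?_, .cons_cons hs ih.2.2⟩
      rw [List.getLast?_cons_cons]
      exact ih.2.1
  · rintro ⟨h1, h2, h3⟩
    induction q generalizing s with
    | nil => simp at h1
    | cons p q ih =>
      obtain rfl : p = s := by simpa using h1
      cases q with
      | nil =>
        obtain rfl : p = e := by simpa using h2
        exact .single _
      | cons p' q =>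
        rw [List.isChain_cons_cons] at h3
        rw [List.getLast?_cons_cons] at h2
        exact .cons h3.1 (ih rfl h2 h3.2)

theorem latticeStep_toLattice {p q : ℕ × ℕ} :
    LatticeStep (toLattice p) (toLattice q) ↔ PathStep p q := by
  obtain ⟨a, b⟩ := p
  obtain ⟨c, d⟩ := q
  simp only [LatticeStep, PathStep, toLattice, Prod.mk.injEq]
  norm_cast

/-- Steps are monotone, so the range condition of `IsPath` follows from the end points. -/
theorem isPath_iff {m n : ℕ} {p : List (ℕ × ℕ)} :
    IsPath m n p ↔ LatticePath (1, 1) (m, n) (p.map toLattice) := by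
  have e1 : (1, 1) = toLattice (1, 1) := rfl
  have e2 : ((m : ℤ), (n : ℤ)) = toLattice (m, n) := rfl
  have key : LatticePath (1, 1) (m, n) (p.map toLattice) ↔
      p.head? = some (1, 1) ∧ p.getLast? = some (m, n) ∧ p.IsChain PathStep := by
    rw [latticePath_iff, List.head?_map, List.getLast?_map, e1, e2, ← Option.map_some (f := toLattice),
      ← Option.map_some (f := toLattice), (Option.map_injective toLattice_injective).eq_iff,
      (Option.map_injective toLattice_injective).eq_iff, List.isChain_map]
    simp only [latticeStep_toLattice]
  rw [IsPath, ← key]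
  refine ⟨fun h => h.2, fun h => ⟨fun x hx => ?_, h⟩⟩
  have := h.bounds.1 (toLattice x) (List.mem_map_of_mem hx)
  simp only [toLattice] at this
  omega

theorem entries_eq_vals (r c : List ℤ) (p : List (ℕ × ℕ)) :
    entries r c p = vals (eltZ r) (eltZ c) (p.map toLattice) := by
  simp [entries, vals, toLattice, mergeMatrix, Function.comp_def]

theorem map_toLattice_range'_col (x a k : ℕ) :
    ((List.range' a k).map fun y => (x, y)).map toLattice = seg x a 0 1 k := by
  induction k generalizing a with
  | zero => rfl
  | succ k ih => simpa [List.range'_succ, seg, toLattice] using ih (a + 1)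

theorem map_toLattice_range'_row (y a k : ℕ) :
    ((List.range' a k).map fun x => (x, y)).map toLattice = seg a y 1 0 k := by
  induction k generalizing a with
  | zero => rfl
  | succ k ih => simpa [List.range'_succ, seg, toLattice] using ih (a + 1)

theorem map_toLattice_rightUp {i j m n : ℕ} (hi : i ≤ m) (hj : j ≤ n) :
    (rightUp i j m n).map toLattice =
      seg i j 0 1 (n - j) ++ seg i n 1 0 (m + 1 - i) := by
  rw [rightUp, List.map_append, map_toLattice_range'_col, map_toLattice_range'_row,
    show n + 1 - j = n - j + 1 by omega, show m + 1 - i = m - i + 1 by omega, seg_succ', seg]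
  simp
  omega

theorem map_toLattice_upRight {i j m n : ℕ} (hi : i ≤ m) (hj : j ≤ n) :
    (upRight i j m n).map toLattice =
      seg i j 1 0 (m - i) ++ seg m j 0 1 (n + 1 - j) := by
  rw [upRight, List.map_append, map_toLattice_range'_col, map_toLattice_range'_row,
    show n + 1 - j = n - j + 1 by omega, show m + 1 - i = m - i + 1 by omega, seg_succ', seg]
  simp
  omega

theorem map_toLattice_chopTop (r c : List ℤ) {i j m n : ℕ} (hi : i ≤ m) (hj : j ≤ n) :
    (chopTop r c i j m n).map toLattice =
      chop (eltZ r) (eltZ c) 1 i j (m + 1 - i) (n + 1 - j) := by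
  induction i, j using chopTop.induct r c m n with
  | case1 i j h1 =>
    rw [chopTop, chop, if_pos h1, if_pos (by omega), map_toLattice_rightUp hi hj]
    congr 2 <;> omega
  | case2 i j h1 h2 =>
    rw [chopTop, chop, if_neg h1, if_pos h2, if_neg (by omega), if_pos (by omega),
      map_toLattice_upRight hi hj]
    congr 2 <;> omega
  | case3 i j h1 h2 h3 ih =>
    rw [chopTop, if_neg h1, if_neg h2, if_pos h3, chop, if_neg (by omega), if_neg (by omega),
      if_pos, List.map_cons, List.map_cons, ih (by omega) hj]
    · simp only [seg, toLattice, List.cons_append, List.nil_append]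
      push_cast
      congr 3
      omega
    · simp only [mergeMatrix, ← eltZ_natCast] at h3
      convert h3 using 3 <;> push_cast <;> ring
  | case4 i j h1 h2 h3 ih =>
    rw [chopTop, if_neg h1, if_neg h2, if_neg h3, chop, if_neg (by omega), if_neg (by omega),
      if_neg, List.map_cons, List.map_cons, ih hi (by omega)]
    · simp only [seg, toLattice, List.cons_append, List.nil_append]
      push_cast
      congr 3
      omega
    · simp only [mergeMatrix, ← eltZ_natCast] at h3
      convert h3 using 4 <;> push_cast <;> ring

theorem reverse_seg (x y e f : ℤ) (k : ℕ) :
    (seg x y e f k).reverse = seg (x + e * (k - 1)) (y + f * (k - 1)) (-e) (-f) k := by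
  induction k with
  | zero => rfl
  | succ k ih =>
    rw [seg_succ', List.reverse_append, ih, seg]
    push_cast
    simp only [List.reverse_singleton, List.singleton_append]
    congr 2 <;> ring_nf

/-- Chop-bottom decides the end of its path first, hence it is a walk from `(m, n)` outwards, listed
in reverse. The numbers of rows and columns still available coincide with the current coordinates.
-/
theorem map_toLattice_chopBottom (r c : List ℤ) {m n : ℕ} (hm : 1 ≤ m) (hn : 1 ≤ n) :
    (chopBottom r c m n).map toLattice =
      (chop (eltZ r) (eltZ c) (-1) m n m n).reverse := by
  induction m, n using chopBottom.induct r c with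
  | case1 m n h1 =>
    rw [chopBottom, chop, if_pos h1, if_pos h1, upRight, List.map_append,
      map_toLattice_range'_col, map_toLattice_range'_row, List.reverse_append, reverse_seg,
      reverse_seg]
    congr 2
    all_goals (push_cast [hn]; ring)
  | case2 m n h1 h2 =>
    rw [chopBottom, chop, if_neg h1, if_pos h2, if_neg h1, if_pos h2, rightUp, List.map_append,
      map_toLattice_range'_col, map_toLattice_range'_row, List.reverse_append, reverse_seg,
      reverse_seg]
    congr 2
    all_goals (push_cast [hm]; ring)
  | case3 m n h1 h2 h3 ih =>
    rw [chopBottom, chop, if_neg h1, if_neg h2, if_neg h1, if_neg h2, if_pos h3, if_pos,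
      List.map_append, ih (by omega) hn, List.reverse_append]
    · congr 2
      · congr 1
        omega
      · simp [seg, toLattice]
        omega
    · simp only [mergeMatrix, ← eltZ_natCast] at h3
      convert h3 using 3 <;> omega
  | case4 m n h1 h2 h3 ih =>
    rw [chopBottom, chop, if_neg h1, if_neg h2, if_neg h1, if_neg h2, if_neg h3, if_neg,
      List.map_append, ih hm (by omega), List.reverse_append]
    · congr 2
      · congr 1
        omega
      · simp [seg, toLattice]
        omega
    · simp only [mergeMatrix, ← eltZ_natCast] at h3
      convert h3 using 4 <;> omega

theorem map_toLattice_splitAndChop (r c : List ℤ) {i j : ℕ} (hi : IsArgmin r i)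
    (hj : IsArgmin c j) : (splitAndChop r c i j).map toLattice =
      (chop (eltZ r) (eltZ c) (-1) i j i j).reverse ++
        (chop (eltZ r) (eltZ c) 1 i j (r.length + 1 - i) (c.length + 1 - j)).tail := by
  rw [splitAndChop, List.map_append, List.map_tail, map_toLattice_chopBottom r c hi.1 hj.1,
    map_toLattice_chopTop r c hi.2.1 hj.2.1]

theorem IsArgmin.eltZ_le {s : List ℤ} {i : ℕ} (h : IsArgmin s i) {z : ℤ} (h1 : 1 ≤ z)
    (h2 : z ≤ s.length) : eltZ s i ≤ eltZ s z := by
  lift z to ℕ using by omega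
  simpa using h.2.2 z (by omega) (by omega)

theorem IsTypical.zigzag_top {s : List ℤ} (hs : IsTypical s) {i : ℕ} (h : IsArgmin s i) :
    Zigzag (eltZ s) i (s.length + 1 - i) := by
  have h1 := h.1
  have h2 := h.2.1
  refine (hs.irred.mono ?_ ?_).zigzag fun z hz hz' => h.eltZ_le ?_ ?_ <;> omega

theorem IsTypical.zigzag_bottom {s : List ℤ} (hs : IsTypical s) {i : ℕ} (h : IsArgmin s i) :
    Zigzag (fun z => eltZ s (-z)) (-i) i := by
  have h1 := h.1
  have h2 := h.2.1
  refine (hs.irred.neg.mono ?_ ?_).zigzag fun z hz hz' => ?_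
  · omega
  · omega
  · simpa using h.eltZ_le (z := -z) (by omega) (by omega)

/-- The correctness of the algorithm. -/
theorem isDominatingPath_splitAndChop {r c : List ℤ} (hr : IsTypical r) (hc : IsTypical c)
    {i j : ℕ} (hi : IsArgmin r i) (hj : IsArgmin c j) :
    IsDominatingPath r c (splitAndChop r c i j) := by
  have hi1 := hi.1
  have hi2 := hi.2.1
  have hj1 := hj.1
  have hj2 := hj.2.1
  have eb : ∀ k : ℕ, 1 ≤ k → (k : ℤ) - (k - 1 : ℕ) = 1 := by intro k hk; omega
  have et : ∀ k l : ℕ, k ≤ l → (k : ℤ) + (l + 1 - k - 1 : ℕ) = l := by intro k l hk; omega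
  have pb := latticePath_reverse_chop (A := eltZ r) (B := eltZ c) (x := i) (y := j) hi1 hj1
  have pt := latticePath_chop (A := eltZ r) (B := eltZ c) (x := i) (y := j)
    (show 1 ≤ r.length + 1 - i by omega) (show 1 ≤ c.length + 1 - j by omega)
  rw [eb i hi1, eb j hj1] at pb
  rw [et i _ hi2, et j _ hj2] at pt
  obtain ⟨pb', hpb'⟩ := pb.exists_eq_append
  obtain ⟨pt', hpt'⟩ := pt.exists_eq_cons
  have e := map_toLattice_splitAndChop r c hi hj
  rw [hpb', hpt', List.tail_cons, List.append_assoc, List.singleton_append] at e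
  refine ⟨?_, fun q hq => Dom.dominates ?_⟩
  · rw [isPath_iff, e]
    rw [hpb'] at pb
    rw [hpt'] at pt
    exact pb.append_shared pt
  · rw [isPath_iff] at hq
    obtain ⟨q₁, q₂, h1, h2, h3⟩ := exists_dom_through (A := eltZ r) (B := eltZ c) (i := i) (j := j)
      hq (by omega) (by omega) (by omega) (by omega)
      (fun x hx hx' => hi.eltZ_le hx hx') (fun y hy hy' => hj.eltZ_le hy hy')
    have db := dom_reverse_chop hi1 hj1 (hr.zigzag_bottom hi) (hc.zigzag_bottom hj)
      (q := q₁ ++ [((i : ℤ), (j : ℤ))]) (by rwa [eb i hi1, eb j hj1])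
    have dt := dom_chop (show 1 ≤ r.length + 1 - i by omega) (show 1 ≤ c.length + 1 - j by omega)
      (hr.zigzag_top hi) (hc.zigzag_top hj) (q := ((i : ℤ), (j : ℤ)) :: q₂)
      (by rwa [et i _ hi2, et j _ hj2])
    rw [entries_eq_vals, entries_eq_vals, e]
    refine Dom.trans ?_ h3
    rw [hpb', vals_append, vals_append] at db
    rw [hpt'] at dt
    simp only [vals_cons, vals_nil] at db dt
    -- Both halves contain `(i, j)`, so it occurs twice here; `Dom.dup_right` passes to the path
    -- that lists it once.
    have := db.append_shared dt
    rw [vals_append, vals_append, vals_cons, vals_cons]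
    refine Dom.trans ?_ this
    simpa using Dom.dup_right (vals (eltZ r) (eltZ c) pb') _ _

/-! ### Reasoning about programs -/

/-- `P` halts when started in `σ`, and `Q` holds for its number of steps and its final state. -/
def Halts (P : Program) (σ : State) (Q : ℕ → State → Prop) : Prop :=
  ∃ t τ, Exec P σ t τ ∧ Q t τ

infixr:65 " ⨾ " => Program.seq

section Halts

variable {P P' : Program} {σ : State} {Q Q' : ℕ → State → Prop} {x y z : ℕ} {k : ℤ}

theorem Halts.mono (h : Halts P σ Q) (hQ : ∀ t τ, Q t τ → Q' t τ) : Halts P σ Q' := by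
  obtain ⟨t, τ, he, hq⟩ := h
  exact ⟨t, τ, he, hQ t τ hq⟩

theorem halts_const (h : Q 1 (σ.setReg x k)) : Halts (.const x k) σ Q :=
  ⟨_, _, .const σ x k, h⟩

theorem halts_add (h : Q 1 (σ.setReg x (σ.reg y + σ.reg z))) : Halts (.add x y z) σ Q :=
  ⟨_, _, .add σ x y z, h⟩

theorem halts_sub (h : Q 1 (σ.setReg x (σ.reg y - σ.reg z))) : Halts (.sub x y z) σ Q :=
  ⟨_, _, .sub σ x y z, h⟩

theorem halts_load (h : Q 1 (σ.setReg x (σ.mem (σ.reg y)))) : Halts (.load x y) σ Q :=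
  ⟨_, _, .load σ x y, h⟩

theorem halts_store (h : Q 1 (σ.setMem (σ.reg x) (σ.reg y))) : Halts (.store x y) σ Q :=
  ⟨_, _, .store σ x y, h⟩

theorem halts_seq (h : Halts P σ fun t τ => Halts P' τ fun u υ => Q (t + u) υ) :
    Halts (P ⨾ P') σ Q := by
  obtain ⟨t, τ, h1, u, υ, h2, hq⟩ := h
  exact ⟨_, _, .seq h1 h2, hq⟩

theorem halts_branch_pos (hc : σ.reg x ≤ σ.reg y) (h : Halts P σ fun t τ => Q (1 + t) τ) :
    Halts (.branch x y P P') σ Q := by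
  obtain ⟨t, τ, h1, hq⟩ := h
  exact ⟨_, _, .branchTrue hc h1, hq⟩

theorem halts_branch_neg (hc : ¬ σ.reg x ≤ σ.reg y) (h : Halts P' σ fun t τ => Q (1 + t) τ) :
    Halts (.branch x y P P') σ Q := by
  obtain ⟨t, τ, h1, hq⟩ := h
  exact ⟨_, _, .branchFalse hc h1, hq⟩

theorem halts_loop_pos (hc : σ.reg x ≤ σ.reg y)
    (h : Halts P σ fun t τ => Halts (.loop x y P) τ fun u υ => Q (1 + t + u) υ) :
    Halts (.loop x y P) σ Q := by
  obtain ⟨t, τ, h1, u, υ, h2, hq⟩ := h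
  exact ⟨_, _, .loopTrue hc h1 h2, hq⟩

theorem halts_loop_neg (hc : ¬ σ.reg x ≤ σ.reg y) (h : Q 1 σ) : Halts (.loop x y P) σ Q :=
  ⟨_, _, .loopFalse hc, h⟩

end Halts

section State

variable (σ : State)

@[simp] theorem State.reg_setReg (x y : ℕ) (v : ℤ) :
    (σ.setReg x v).reg y = if y = x then v else σ.reg y := by
  simp [State.setReg, Function.update_apply]

@[simp] theorem State.mem_setReg (x : ℕ) (v : ℤ) : (σ.setReg x v).mem = σ.mem := rfl

@[simp] theorem State.reg_setMem (a v : ℤ) : (σ.setMem a v).reg = σ.reg := rfl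

@[simp] theorem State.mem_setMem (a v : ℤ) :
    (σ.setMem a v).mem = Function.update σ.mem a v := rfl

end State

/-! ### Storing points -/

/-- The memory after storing the points of a list in pairs of consecutive cells, the first one
at the address `p` and each following one `d` cells further. -/
def writePoints (d : ℤ) : ℤ → List (ℤ × ℤ) → (ℤ → ℤ) → ℤ → ℤ
  | _, [], μ => μ
  | p, a :: l, μ => writePoints d (p + d) l (Function.update (Function.update μ p a.1) (p + 1) a.2)

theorem writePoints_append (d p : ℤ) (l l' : List (ℤ × ℤ)) (μ : ℤ → ℤ) :
    writePoints d p (l ++ l') μ = writePoints d (p + d * l.length) l' (writePoints d p l μ) := by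
  induction l generalizing p μ with
  | nil => simp [writePoints]
  | cons a l ih =>
    simp only [List.cons_append, writePoints, ih, List.length_cons]
    congr 1
    push_cast
    ring

theorem writePoints_apply_of_ne {d p : ℤ} {l : List (ℤ × ℤ)} {μ : ℤ → ℤ} {a : ℤ}
    (h : ∀ t : ℕ, t < l.length → a ≠ p + d * t ∧ a ≠ p + d * t + 1) :
    writePoints d p l μ a = μ a := by
  induction l generalizing p μ with
  | nil => rfl
  | cons b l ih =>
    have h0 := h 0 (by simp)
    rw [writePoints, ih]
    · simp at h0
      simp [h0.1, h0.2]
    · intro t ht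
      have := h (t + 1) (by simpa using ht)
      push_cast at this
      rwa [show p + d + d * t = p + d * (t + 1) by ring]

theorem writePoints_apply {d p : ℤ} {l : List (ℤ × ℤ)} {μ : ℤ → ℤ} {t : ℕ} (ht : t < l.length)
    (hd : d = 2 ∨ d = -2) :
    writePoints d p l μ (p + d * t) = l[t].1 ∧ writePoints d p l μ (p + d * t + 1) = l[t].2 := by
  induction l generalizing p μ t with
  | nil => simp at ht
  | cons b l ih =>
    cases t with
    | zero =>
      rw [writePoints, writePoints_apply_of_ne, writePoints_apply_of_ne]
      · simp
      · rcases hd with rfl | rfl <;> intro t _ <;> push_cast <;> omega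
      · rcases hd with rfl | rfl <;> intro t _ <;> push_cast <;> omega
    | succ t =>
      have := ih (p := p + d)
        (μ := Function.update (Function.update μ p b.1) (p + 1) b.2) (t := t) (by simpa using ht)
      rw [show p + d + d * t = p + d * (t + 1 : ℕ) by push_cast; ring] at this
      simpa [writePoints] using this

/-! ### The program

Registers: `2, 3` lengths of the sequences; `4, 5` positions of minima; `6` direction;
`7, 8` current point; `9, 10` remaining rows and columns; `11` current output address;
`12` number of points; `13, 28, 21, 22` the constants `1, 2, 3, 0`; `23` base address of the second
sequence; `29` output address of the first point. The others are temporary. -/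

/-- Store `k` points, beginning with the current one, in the direction given by the registers
`15` and `16`; here `k` is the content of register `17`. -/
def lineProgram : Program :=
  .loop 13 17 (.store 11 7 ⨾ .add 18 11 13 ⨾ .store 18 8 ⨾ .add 11 11 14 ⨾ .add 12 12 13 ⨾
    .add 7 7 15 ⨾ .add 8 8 16 ⨾ .sub 17 17 13)

/-- The effect of `lineProgram`. -/
structure LineSpec (σ : State) (k t : ℕ) (τ : State) : Prop where
  time : t ≤ 9 * k + 1
  row : τ.reg 7 = σ.reg 7 + σ.reg 15 * k
  col : τ.reg 8 = σ.reg 8 + σ.reg 16 * k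
  ptr : τ.reg 11 = σ.reg 11 + σ.reg 14 * k
  count : τ.reg 12 = σ.reg 12 + k
  frame : ∀ a, a ∉ [7, 8, 11, 12, 17, 18] → τ.reg a = σ.reg a
  mem : τ.mem = writePoints (σ.reg 14) (σ.reg 11)
    (seg (σ.reg 7) (σ.reg 8) (σ.reg 15) (σ.reg 16) k) σ.mem

theorem halts_line (k : ℕ) {σ : State} (h1 : σ.reg 13 = 1) (hk : σ.reg 17 = k) :
    Halts lineProgram σ (LineSpec σ k) := by
  induction k generalizing σ with
  | zero =>
    refine halts_loop_neg (by omega) ?_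
    exact ⟨by omega, by simp, by simp, by simp, by simp, by simp, by simp [seg, writePoints]⟩
  | succ k ih =>
    refine halts_loop_pos (by omega) ?_
    apply halts_seq; apply halts_store
    apply halts_seq; apply halts_add
    apply halts_seq; apply halts_store
    apply halts_seq; apply halts_add
    apply halts_seq; apply halts_add
    apply halts_seq; apply halts_add
    apply halts_seq; apply halts_add
    apply halts_sub
    refine (ih (by simp [h1]) (by simp [h1, hk])).mono fun t τ h => ?_
    obtain ⟨i1, i2, i3, i4, i5, i6, i7⟩ := h
    simp [h1] at i2 i3 i4 i5 i6 i7
    refine ⟨by omega, ?_, ?_, ?_, ?_, ?_, ?_⟩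
    · rw [i2]; push_cast; ring
    · rw [i3]; push_cast; ring
    · rw [i4]; push_cast; ring
    · rw [i5]; push_cast; ring
    · intro a ha
      simp at ha
      rw [i6 a (by tauto) (by tauto) (by tauto) (by tauto) (by tauto) (by tauto)]
      simp [ha]
    · rw [i7, seg, writePoints]

/-- The position of a minimum of a sequence, given by its base address in register `18` and its
length in register `17`. -/
def argminProgram : Program :=
  .const 19 1 ⨾ .add 26 18 13 ⨾ .load 24 26 ⨾ .const 20 2 ⨾
  .loop 20 17 (.add 26 18 20 ⨾ .load 25 26 ⨾
    .branch 24 25 (.const 25 0) (.add 19 20 22 ⨾ .add 24 25 22) ⨾ .add 20 20 13)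

/-- The effect of `argminProgram`. -/
structure ArgminSpec (σ : State) (s : List ℤ) (t : ℕ) (τ : State) : Prop where
  time : t ≤ 10 * s.length + 10
  exists_argmin : ∃ i : ℕ, IsArgmin s i ∧ τ.reg 19 = i
  frame : ∀ a, a ∉ [19, 20, 24, 25, 26] → τ.reg a = σ.reg a
  mem : τ.mem = σ.mem

theorem halts_argmin {σ : State} {s : List ℤ} (hs : s ≠ []) (h1 : σ.reg 13 = 1)
    (h0 : σ.reg 22 = 0) (hlen : σ.reg 17 = s.length)
    (hmem : ∀ k : ℕ, 1 ≤ k → k ≤ s.length → σ.mem (σ.reg 18 + k) = elt s k) :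
    Halts argminProgram σ (ArgminSpec σ s) := by
  have hpos : 1 ≤ s.length := List.length_pos_iff.2 hs
  have loop : ∀ (l k i : ℕ) (ρ : State), k + l = s.length → 1 ≤ i → i ≤ k →
      (∀ a, a ∉ [19, 20, 24, 25, 26] → ρ.reg a = σ.reg a) → ρ.mem = σ.mem →
      ρ.reg 19 = i → ρ.reg 20 = (k + 1 : ℕ) → ρ.reg 24 = elt s i →
      (∀ k', 1 ≤ k' → k' ≤ k → elt s i ≤ elt s k') →
      Halts (.loop 20 17 (.add 26 18 20 ⨾ .load 25 26 ⨾
        .branch 24 25 (.const 25 0) (.add 19 20 22 ⨾ .add 24 25 22) ⨾ .add 20 20 13)) ρ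
        (fun t τ => t ≤ 10 * l + 1 ∧ (∃ i : ℕ, IsArgmin s i ∧ τ.reg 19 = i) ∧
          (∀ a, a ∉ [19, 20, 24, 25, 26] → τ.reg a = σ.reg a) ∧ τ.mem = σ.mem) := by
    intro l
    induction l with
    | zero =>
      intro k i ρ hk hi hik hf hm h19 h20 h24 hmin
      have f17 := hf 17 (by simp)
      refine halts_loop_neg (by omega) ⟨by omega, ⟨i, ⟨hi, by omega, ?_⟩, h19⟩, hf, hm⟩
      exact fun k' h h' => hmin k' h (by omega)
    | succ l ih =>
      intro k i ρ hk hi hik hf hm h19 h20 h24 hmin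
      have f17 := hf 17 (by simp)
      have f18 := hf 18 (by simp)
      have f13 := hf 13 (by simp)
      have f22 := hf 22 (by simp)
      have hv : σ.mem (σ.reg 18 + ((k : ℤ) + 1)) = elt s (k + 1) := by
        simpa using hmem (k + 1) (by omega) (by omega)
      refine halts_loop_pos (by omega) ?_
      apply halts_seq; apply halts_add
      apply halts_seq; apply halts_load
      apply halts_seq
      by_cases hc : elt s i ≤ elt s (k + 1)
      · apply halts_branch_pos (by simpa [h24, hm, f18, h20, hv] using hc)
        apply halts_const
        apply halts_add
        refine (ih (k + 1) i _ (by omega) hi (by omega) ?_ (by simpa using hm) (by simpa using h19)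
          (by simp [h20, f13, h1]) (by simpa using h24) ?_).mono fun t τ h => ⟨by omega, h.2⟩
        · intro a ha
          rw [← hf a ha]
          simp at ha
          simp [ha]
        · intro k' h h'
          rcases Nat.lt_or_ge k k' with h3 | h3
          · obtain rfl : k' = k + 1 := by omega
            exact hc
          · exact hmin k' h h3
      · apply halts_branch_neg (by simpa [h24, hm, f18, h20, hv] using hc)
        apply halts_seq; apply halts_add; apply halts_add
        apply halts_add
        refine (ih (k + 1) (k + 1) _ (by omega) (by omega) le_rfl ?_ (by simpa using hm)
          (by simp [h20, f22, h0]) (by simp [h20, f13, h1])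
          (by simp [h20, f22, h0, hm, f18, hv]) ?_).mono fun t τ h => ⟨by omega, h.2⟩
        · intro a ha
          rw [← hf a ha]
          simp at ha
          simp [ha]
        · intro k' h h'
          rcases Nat.lt_or_ge k k' with h3 | h3
          · obtain rfl : k' = k + 1 := by omega
            exact le_rfl
          · exact (le_of_not_ge hc).trans (hmin k' h h3)
  apply halts_seq; apply halts_const
  apply halts_seq; apply halts_add
  apply halts_seq; apply halts_load
  apply halts_seq; apply halts_const
  refine (loop (s.length - 1) 1 1 _ (by omega) le_rfl le_rfl ?_ (by simp) (by simp) (by simp)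
    ?_ ?_).mono fun t τ h => ⟨by omega, h.2.1, h.2.2.1, h.2.2.2⟩
  · intro a ha
    simp at ha
    simp [ha]
  · simpa [h1] using hmem 1 le_rfl hpos
  · intro k' h h'
    obtain rfl : k' = 1 := by omega
    exact le_rfl

/-- Register `19` becomes the minimum of the numbers of remaining rows and columns. -/
def minProgram : Program := .branch 9 10 (.add 19 9 22) (.add 19 10 22)

theorem halts_min {σ : State} (h0 : σ.reg 22 = 0) :
    Halts minProgram σ fun t τ => t = 2 ∧ τ = σ.setReg 19 (min (σ.reg 9) (σ.reg 10)) := by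
  by_cases hc : σ.reg 9 ≤ σ.reg 10
  · apply halts_branch_pos hc
    apply halts_add
    simp [h0, hc]
  · apply halts_branch_neg hc
    apply halts_add
    simp [h0, le_of_not_ge hc]

/-- Two points in the direction given by the registers `15` and `16`. -/
def twoProgram : Program := .const 17 2 ⨾ lineProgram ⨾ minProgram

/-- Evaluation of the test of the chop procedure and choice of the direction. -/
def testProgram : Program :=
  .add 18 7 13 ⨾ .add 18 18 6 ⨾ .load 24 18 ⨾ .add 18 18 6 ⨾ .load 25 18 ⨾
  .add 18 8 23 ⨾ .add 18 18 6 ⨾ .load 26 18 ⨾ .add 18 18 6 ⨾ .load 27 18 ⨾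
  .add 25 25 26 ⨾ .add 24 24 27 ⨾
  .branch 25 24 (.add 15 6 22 ⨾ .const 16 0 ⨾ .sub 9 9 28)
    (.const 15 0 ⨾ .add 16 6 22 ⨾ .sub 10 10 28)

/-- The final part of the chop procedure. -/
def chopEndProgram : Program :=
  .branch 9 28
    (.const 15 0 ⨾ .add 16 6 22 ⨾ .sub 17 10 13 ⨾ lineProgram ⨾
      .add 15 6 22 ⨾ .const 16 0 ⨾ .add 17 9 22 ⨾ lineProgram)
    (.add 15 6 22 ⨾ .const 16 0 ⨾ .sub 17 9 13 ⨾ lineProgram ⨾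
      .const 15 0 ⨾ .add 16 6 22 ⨾ .add 17 10 22 ⨾ lineProgram)

/-- The main loop of the chop procedure. -/
def chopLoopProgram : Program := .loop 21 19 (testProgram ⨾ twoProgram)

/-- The chop procedure. -/
def chopProgram : Program := .add 14 6 6 ⨾ minProgram ⨾ chopLoopProgram ⨾ chopEndProgram

/-- The effect of `twoProgram`. -/
structure TwoSpec (σ : State) (t : ℕ) (τ : State) : Prop where
  time : t ≤ 30
  row : τ.reg 7 = σ.reg 7 + σ.reg 15 * 2
  col : τ.reg 8 = σ.reg 8 + σ.reg 16 * 2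
  ptr : τ.reg 11 = σ.reg 11 + σ.reg 14 * 2
  count : τ.reg 12 = σ.reg 12 + 2
  min : τ.reg 19 = min (σ.reg 9) (σ.reg 10)
  frame : ∀ a, a ∉ [7, 8, 11, 12, 17, 18, 19] → τ.reg a = σ.reg a
  mem : τ.mem = writePoints (σ.reg 14) (σ.reg 11)
    (seg (σ.reg 7) (σ.reg 8) (σ.reg 15) (σ.reg 16) 2) σ.mem

theorem halts_two {σ : State} (h1 : σ.reg 13 = 1) (h0 : σ.reg 22 = 0) :
    Halts twoProgram σ (TwoSpec σ) := by
  apply halts_seq; apply halts_const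
  apply halts_seq
  refine (halts_line 2 (by simpa using h1) (by simp)).mono fun t τ h => ?_
  obtain ⟨i1, i2, i3, i4, i5, i6, i7⟩ := h
  have e0 := i6 22 (by simp)
  have e9 := i6 9 (by simp)
  have e10 := i6 10 (by simp)
  simp at i2 i3 i4 i5 i7 e0 e9 e10
  refine (halts_min (by omega)).mono fun t' τ' h => ?_
  obtain ⟨rfl, rfl⟩ := h
  refine ⟨by omega, by simpa using i2, by simpa using i3, by simpa using i4, by simpa using i5,
    by simp [e9, e10], fun a ha => ?_, by simpa using i7⟩
  have := i6 a (by simp at ha ⊢; tauto)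
  simp at ha
  simpa [ha] using this

/-- The situation before an iteration of the chop procedure: the input is stored in cells up to
`L`, and the output will be stored in cells beyond `L`. -/
structure ChopPre (A B : ℤ → ℤ) (d x y : ℤ) (u v : ℕ) (L : ℤ) (σ : State) : Prop where
  one : σ.reg 13 = 1
  two : σ.reg 28 = 2
  three : σ.reg 21 = 3
  zero : σ.reg 22 = 0
  dir : σ.reg 6 = d
  row : σ.reg 7 = x
  col : σ.reg 8 = y
  rows : σ.reg 9 = u
  cols : σ.reg 10 = v
  rows_pos : 1 ≤ u
  cols_pos : 1 ≤ v
  ptr : ∀ t : ℕ, t < u + v → L < σ.reg 11 + 2 * d * t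
  memA : ∀ t : ℕ, t < u → x + 1 + d * t ≤ L ∧ σ.mem (x + 1 + d * t) = A (x + d * t)
  memB : ∀ t : ℕ, t < v → y + σ.reg 23 + d * t ≤ L ∧
    σ.mem (y + σ.reg 23 + d * t) = B (y + d * t)

/-- The effect of the chop procedure. -/
structure ChopSpec (A B : ℤ → ℤ) (d x y : ℤ) (u v : ℕ) (σ : State) (t : ℕ) (τ : State) :
    Prop where
  time : t ≤ 60 * (u + v)
  count : τ.reg 12 = σ.reg 12 + (chop A B d x y u v).length
  frame : ∀ a, a ∉ [7, 8, 9, 10, 11, 12, 14, 15, 16, 17, 18, 19, 24, 25, 26, 27] →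
    τ.reg a = σ.reg a
  mem : τ.mem = writePoints (2 * d) (σ.reg 11) (chop A B d x y u v) σ.mem

section chop

variable {A B : ℤ → ℤ} {d x y L : ℤ} {u v : ℕ} {σ : State}

theorem halts_chopEnd (h : ChopPre A B d x y u v L σ) (h14 : σ.reg 14 = 2 * d)
    (huv : u ≤ 2 ∨ v ≤ 2) :
    Halts chopEndProgram σ (fun t τ => ChopSpec A B d x y u v σ (t + 1) τ) := by
  have hu := h.rows_pos
  have hv := h.cols_pos
  by_cases hc : u ≤ 2
  · apply halts_branch_pos (by rw [h.rows, h.two]; exact_mod_cast hc)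
    apply halts_seq; apply halts_const
    apply halts_seq; apply halts_add
    apply halts_seq; apply halts_sub
    apply halts_seq
    refine (halts_line (v - 1) (by simpa using h.one)
      (by simp [h.cols, h.one]; omega)).mono fun t τ i => ?_
    obtain ⟨i1, i2, i3, i4, i5, i6, i7⟩ := i
    have e6 := i6 6 (by simp)
    have e22 := i6 22 (by simp)
    have e9 := i6 9 (by simp)
    have e13 := i6 13 (by simp)
    have e14 := i6 14 (by simp)
    simp [h.dir, h.zero, h.rows, h.one, h14, h.row, h.col] at i2 i3 i4 i5 i7 e6 e22 e9 e13 e14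
    apply halts_seq; apply halts_add
    apply halts_seq; apply halts_const
    apply halts_seq; apply halts_add
    refine (halts_line u (by simpa using e13) (by simp [e9, e22])).mono fun t' τ' j => ?_
    obtain ⟨j1, j2, j3, j4, j5, j6, j7⟩ := j
    simp [e6, e22, e14, i2, i3, i4, i5] at j2 j3 j4 j5 j7
    refine ⟨by omega, ?_, fun a ha => ?_, ?_⟩
    · rw [j5, chop, if_pos hc]
      simp
      ring
    · have f1 := i6 a (by simp at ha ⊢; tauto)
      have f2 := j6 a (by simp at ha ⊢; tauto)
      simp at ha
      simp [ha] at f1 f2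
      rw [f2, f1]
    · rw [j7, i7, chop, if_pos hc, writePoints_append, length_seg]
  · have hc' : v ≤ 2 := by omega
    apply halts_branch_neg (by rw [h.rows, h.two]; exact_mod_cast hc)
    apply halts_seq; apply halts_add
    apply halts_seq; apply halts_const
    apply halts_seq; apply halts_sub
    apply halts_seq
    refine (halts_line (u - 1) (by simpa using h.one)
      (by simp [h.rows, h.one]; omega)).mono fun t τ i => ?_
    obtain ⟨i1, i2, i3, i4, i5, i6, i7⟩ := i
    have e6 := i6 6 (by simp)
    have e22 := i6 22 (by simp)
    have e10 := i6 10 (by simp)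
    have e13 := i6 13 (by simp)
    have e14 := i6 14 (by simp)
    simp [h.dir, h.zero, h.cols, h.one, h14, h.row, h.col] at i2 i3 i4 i5 i7 e6 e22 e10 e13 e14
    apply halts_seq; apply halts_const
    apply halts_seq; apply halts_add
    apply halts_seq; apply halts_add
    refine (halts_line v (by simpa using e13) (by simp [e10, e22])).mono fun t' τ' j => ?_
    obtain ⟨j1, j2, j3, j4, j5, j6, j7⟩ := j
    simp [e6, e22, e14, i2, i3, i4, i5] at j2 j3 j4 j5 j7
    refine ⟨by omega, ?_, fun a ha => ?_, ?_⟩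
    · rw [j5, chop, if_neg hc, if_pos hc']
      simp
      ring
    · have f1 := i6 a (by simp at ha ⊢; tauto)
      have f2 := j6 a (by simp at ha ⊢; tauto)
      simp at ha
      simp [ha] at f1 f2
      rw [f2, f1]
    · rw [j7, i7, chop, if_neg hc, if_pos hc', writePoints_append, length_seg]

/-- The effect of `testProgram`. -/
structure TestSpec (A B : ℤ → ℤ) (d x y : ℤ) (σ : State) (t : ℕ) (τ : State) : Prop where
  time : t ≤ 16
  frame : ∀ a, a ∉ [9, 10, 15, 16, 18, 24, 25, 26, 27] → τ.reg a = σ.reg a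
  mem : τ.mem = σ.mem
  pos : A (x + 2 * d) + B (y + d) ≤ A (x + d) + B (y + 2 * d) →
    τ.reg 15 = d ∧ τ.reg 16 = 0 ∧ τ.reg 9 = σ.reg 9 - 2 ∧ τ.reg 10 = σ.reg 10
  neg : ¬ A (x + 2 * d) + B (y + d) ≤ A (x + d) + B (y + 2 * d) →
    τ.reg 15 = 0 ∧ τ.reg 16 = d ∧ τ.reg 9 = σ.reg 9 ∧ τ.reg 10 = σ.reg 10 - 2

theorem halts_test (h : ChopPre A B d x y u v L σ) (hu : ¬ u ≤ 2) (hv : ¬ v ≤ 2) :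
    Halts testProgram σ (TestSpec A B d x y σ) := by
  have a1 := (h.memA 1 (by omega)).2
  have a2 := (h.memA 2 (by omega)).2
  have b1 := (h.memB 1 (by omega)).2
  have b2 := (h.memB 2 (by omega)).2
  rw [show x + 1 + d * (2 : ℕ) = x + 1 + d + d by push_cast; ring,
    show x + d * (2 : ℕ) = x + 2 * d by push_cast; ring] at a2
  rw [show y + σ.reg 23 + d * (2 : ℕ) = y + σ.reg 23 + d + d by push_cast; ring,
    show y + d * (2 : ℕ) = y + 2 * d by push_cast; ring] at b2
  simp only [Nat.cast_one, mul_one] at a1 b1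
  apply halts_seq; apply halts_add
  apply halts_seq; apply halts_add
  apply halts_seq; apply halts_load
  apply halts_seq; apply halts_add
  apply halts_seq; apply halts_load
  apply halts_seq; apply halts_add
  apply halts_seq; apply halts_add
  apply halts_seq; apply halts_load
  apply halts_seq; apply halts_add
  apply halts_seq; apply halts_load
  apply halts_seq; apply halts_add
  apply halts_seq; apply halts_add
  by_cases hc : A (x + 2 * d) + B (y + d) ≤ A (x + d) + B (y + 2 * d)
  · apply halts_branch_pos (by simpa [h.row, h.col, h.one, h.dir, a1, a2, b1, b2] using hc)
    apply halts_seq; apply halts_add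
    apply halts_seq; apply halts_const
    apply halts_sub
    refine ⟨by omega, fun a ha => ?_, by simp, fun _ => ?_, fun h' => absurd hc h'⟩
    · simp at ha
      simp [ha]
    · simp [h.dir, h.zero, h.two]
  · apply halts_branch_neg (by simpa [h.row, h.col, h.one, h.dir, a1, a2, b1, b2] using hc)
    apply halts_seq; apply halts_const
    apply halts_seq; apply halts_add
    apply halts_sub
    refine ⟨by omega, fun a ha => ?_, by simp, fun h' => absurd h' hc, fun _ => ?_⟩
    · simp at ha
      simp [ha]
    · simp [h.dir, h.zero, h.two]

theorem ChopPre.two_rows (h : ChopPre A B d x y u v L σ) (hu : ¬ u ≤ 2) {ρ τ : State} {t t' : ℕ}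
    (h14 : σ.reg 14 = 2 * d)
    (hc : A (x + 2 * d) + B (y + d) ≤ A (x + d) + B (y + 2 * d))
    (h1 : TestSpec A B d x y σ t ρ) (h2 : TwoSpec ρ t' τ) :
    ChopPre A B d (x + 2 * d) y (u - 2) v L τ ∧ τ.reg 14 = 2 * d ∧
      τ.reg 19 = min (u - 2 : ℕ) v ∧ τ.reg 11 = σ.reg 11 + 2 * d * 2 ∧
      τ.reg 12 = σ.reg 12 + 2 ∧
      τ.mem = writePoints (2 * d) (σ.reg 11) (seg x y d 0 2) σ.mem := by
  obtain ⟨g15, g16, g9, g10⟩ := h1.pos hc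
  have f : ∀ a, a ∉ [7, 8, 9, 10, 11, 12, 15, 16, 17, 18, 19, 24, 25, 26, 27] →
      τ.reg a = σ.reg a := by
    intro a ha
    rw [h2.frame a (by simp at ha ⊢; tauto), h1.frame a (by simp at ha ⊢; tauto)]
  have r7 := h1.frame 7 (by simp)
  have r8 := h1.frame 8 (by simp)
  have r11 := h1.frame 11 (by simp)
  have r12 := h1.frame 12 (by simp)
  have r14 := h1.frame 14 (by simp)
  have hm : τ.mem = writePoints (2 * d) (σ.reg 11) (seg x y d 0 2) σ.mem := by
    rw [h2.mem, h1.mem, g15, g16, r7, r8, r11, r14, h14, h.row, h.col]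
  have hin : ∀ a ≤ L, τ.mem a = σ.mem a := by
    intro a ha
    rw [hm]
    refine writePoints_apply_of_ne fun t ht => ?_
    have := h.ptr t (by simp at ht; omega)
    omega
  have hp : τ.reg 11 = σ.reg 11 + 2 * d * 2 := by rw [h2.ptr, r11, r14, h14]
  refine ⟨⟨?_, ?_, ?_, ?_, ?_, ?_, ?_, ?_, ?_, by omega, h.cols_pos, ?_, ?_, ?_⟩, ?_, ?_, hp, ?_, hm⟩
  · rw [f 13 (by simp), h.one]
  · rw [f 28 (by simp), h.two]
  · rw [f 21 (by simp), h.three]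
  · rw [f 22 (by simp), h.zero]
  · rw [f 6 (by simp), h.dir]
  · rw [h2.row, g15, r7, h.row]; ring
  · rw [h2.col, g16, r8, h.col]; ring
  · rw [h2.frame 9 (by simp), g9, h.rows]; omega
  · rw [h2.frame 10 (by simp), g10, h.cols]
  · intro s hs
    have := h.ptr (s + 2) (by omega)
    rw [hp]
    push_cast at this
    linarith
  · intro s hs
    obtain ⟨k1, k2⟩ := h.memA (s + 2) (by omega)
    rw [show x + 1 + d * (s + 2 : ℕ) = x + 2 * d + 1 + d * s by push_cast; ring] at k1 k2
    rw [show x + d * (s + 2 : ℕ) = x + 2 * d + d * s by push_cast; ring] at k2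
    exact ⟨k1, by rw [hin _ k1, k2]⟩
  · intro s hs
    obtain ⟨k1, k2⟩ := h.memB s hs
    rw [f 23 (by simp)]
    exact ⟨k1, by rw [hin _ k1, k2]⟩
  · rw [f 14 (by simp), h14]
  · rw [h2.min, g9, g10, h.rows, h.cols]
    push_cast [show 2 ≤ u by omega]
    rfl
  · rw [h2.count, r12]

theorem ChopPre.two_cols (h : ChopPre A B d x y u v L σ) (hv : ¬ v ≤ 2) {ρ τ : State} {t t' : ℕ}
    (h14 : σ.reg 14 = 2 * d)
    (hc : ¬ A (x + 2 * d) + B (y + d) ≤ A (x + d) + B (y + 2 * d))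
    (h1 : TestSpec A B d x y σ t ρ) (h2 : TwoSpec ρ t' τ) :
    ChopPre A B d x (y + 2 * d) u (v - 2) L τ ∧ τ.reg 14 = 2 * d ∧
      τ.reg 19 = min u (v - 2 : ℕ) ∧ τ.reg 11 = σ.reg 11 + 2 * d * 2 ∧
      τ.reg 12 = σ.reg 12 + 2 ∧
      τ.mem = writePoints (2 * d) (σ.reg 11) (seg x y 0 d 2) σ.mem := by
  obtain ⟨g15, g16, g9, g10⟩ := h1.neg hc
  have f : ∀ a, a ∉ [7, 8, 9, 10, 11, 12, 15, 16, 17, 18, 19, 24, 25, 26, 27] →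
      τ.reg a = σ.reg a := by
    intro a ha
    rw [h2.frame a (by simp at ha ⊢; tauto), h1.frame a (by simp at ha ⊢; tauto)]
  have r7 := h1.frame 7 (by simp)
  have r8 := h1.frame 8 (by simp)
  have r11 := h1.frame 11 (by simp)
  have r12 := h1.frame 12 (by simp)
  have r14 := h1.frame 14 (by simp)
  have hm : τ.mem = writePoints (2 * d) (σ.reg 11) (seg x y 0 d 2) σ.mem := by
    rw [h2.mem, h1.mem, g15, g16, r7, r8, r11, r14, h14, h.row, h.col]
  have hin : ∀ a ≤ L, τ.mem a = σ.mem a := by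
    intro a ha
    rw [hm]
    refine writePoints_apply_of_ne fun t ht => ?_
    have := h.ptr t (by simp at ht; omega)
    omega
  have hp : τ.reg 11 = σ.reg 11 + 2 * d * 2 := by rw [h2.ptr, r11, r14, h14]
  refine ⟨⟨?_, ?_, ?_, ?_, ?_, ?_, ?_, ?_, ?_, h.rows_pos, by omega, ?_, ?_, ?_⟩, ?_, ?_, hp, ?_, hm⟩
  · rw [f 13 (by simp), h.one]
  · rw [f 28 (by simp), h.two]
  · rw [f 21 (by simp), h.three]
  · rw [f 22 (by simp), h.zero]
  · rw [f 6 (by simp), h.dir]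
  · rw [h2.row, g15, r7, h.row]; ring
  · rw [h2.col, g16, r8, h.col]; ring
  · rw [h2.frame 9 (by simp), g9, h.rows]
  · rw [h2.frame 10 (by simp), g10, h.cols]; omega
  · intro s hs
    have := h.ptr (s + 2) (by omega)
    rw [hp]
    push_cast at this
    linarith
  · intro s hs
    obtain ⟨k1, k2⟩ := h.memA s hs
    exact ⟨k1, by rw [hin _ k1, k2]⟩
  · intro s hs
    obtain ⟨k1, k2⟩ := h.memB (s + 2) (by omega)
    rw [show y + σ.reg 23 + d * (s + 2 : ℕ) = y + 2 * d + σ.reg 23 + d * s by push_cast; ring]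
      at k1 k2
    rw [show y + d * (s + 2 : ℕ) = y + 2 * d + d * s by push_cast; ring] at k2
    rw [f 23 (by simp)]
    exact ⟨k1, by rw [hin _ k1, k2]⟩
  · rw [f 14 (by simp), h14]
  · rw [h2.min, g9, g10, h.rows, h.cols]
    push_cast [show 2 ≤ v by omega]
    rfl
  · rw [h2.count, r12]

theorem halts_chopLoop (h : ChopPre A B d x y u v L σ) (h14 : σ.reg 14 = 2 * d)
    (h19 : σ.reg 19 = min u v) :
    Halts chopLoopProgram σ fun t τ => Halts chopEndProgram τ fun t' υ =>
      ChopSpec A B d x y u v σ (t + t') υ := by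
  induction hN : u + v using Nat.strong_induction_on generalizing x y u v σ with
  | _ N ih =>
    have hmin : σ.reg 21 ≤ σ.reg 19 ↔ ¬ u ≤ 2 ∧ ¬ v ≤ 2 := by
      rw [h.three, h19]
      omega
    by_cases hc : ¬ u ≤ 2 ∧ ¬ v ≤ 2
    · refine halts_loop_pos (hmin.2 hc) ?_
      apply halts_seq
      refine (halts_test h hc.1 hc.2).mono fun t ρ h1 => ?_
      refine (halts_two (by rw [h1.frame 13 (by simp), h.one])
        (by rw [h1.frame 22 (by simp), h.zero])).mono fun t' τ h2 => ?_
      have l1 := h1.time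
      have l2 := h2.time
      have f : ∀ a, a ∉ [7, 8, 9, 10, 11, 12, 14, 15, 16, 17, 18, 19, 24, 25, 26, 27] →
          τ.reg a = σ.reg a := by
        intro a ha
        rw [h2.frame a (by simp at ha ⊢; tauto), h1.frame a (by simp at ha ⊢; tauto)]
      by_cases ht : A (x + 2 * d) + B (y + d) ≤ A (x + d) + B (y + 2 * d)
      · obtain ⟨k1, k2, k3, k4, k5, k6⟩ := h.two_rows hc.1 h14 ht h1 h2
        refine (ih _ (by omega) k1 k2 k3 rfl).mono fun t₁ τ₁ h3 => h3.mono fun t₂ τ₂ h4 => ?_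
        have l3 := h4.time
        refine ⟨by omega, ?_, fun a ha => by rw [h4.frame a ha, f a ha], ?_⟩
        · rw [h4.count, k5, chop.eq_1 A B d x y u v, if_neg hc.1, if_neg hc.2, if_pos ht,
            List.length_append, length_seg]
          push_cast
          ring
        · rw [h4.mem, k6, k4, chop.eq_1 A B d x y u v, if_neg hc.1, if_neg hc.2, if_pos ht,
            writePoints_append, length_seg]
          rfl
      · obtain ⟨k1, k2, k3, k4, k5, k6⟩ := h.two_cols hc.2 h14 ht h1 h2
        refine (ih _ (by omega) k1 k2 k3 rfl).mono fun t₁ τ₁ h3 => h3.mono fun t₂ τ₂ h4 => ?_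
        have l3 := h4.time
        refine ⟨by omega, ?_, fun a ha => by rw [h4.frame a ha, f a ha], ?_⟩
        · rw [h4.count, k5, chop.eq_1 A B d x y u v, if_neg hc.1, if_neg hc.2, if_neg ht,
            List.length_append, length_seg]
          push_cast
          ring
        · rw [h4.mem, k6, k4, chop.eq_1 A B d x y u v, if_neg hc.1, if_neg hc.2, if_neg ht,
            writePoints_append, length_seg]
          rfl
    · refine halts_loop_neg (fun h' => hc (hmin.1 h')) ?_
      refine (halts_chopEnd h h14 (by omega)).mono fun t τ h' => ?_
      rwa [add_comm] at h'

theorem halts_chop (h : ChopPre A B d x y u v L σ) :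
    Halts chopProgram σ fun t τ => ∃ t', t = t' + 3 ∧ ChopSpec A B d x y u v σ t' τ := by
  apply halts_seq; apply halts_add
  apply halts_seq
  refine (halts_min (by simpa using h.zero)).mono fun t τ ht => ?_
  obtain ⟨rfl, rfl⟩ := ht
  apply halts_seq
  refine (halts_chopLoop (A := A) (B := B) (d := d) (x := x) (y := y) (u := u) (v := v) (L := L)
    ?_ ?_ ?_).mono fun t τ h' => h'.mono fun t' τ' i => ⟨t + t', by omega, ?_⟩
  · exact ⟨h.one, h.two, h.three, h.zero, h.dir, h.row, h.col, h.rows, h.cols, h.rows_pos,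
      h.cols_pos, h.ptr, h.memA, h.memB⟩
  · simp [h.dir]
    ring
  · simp [h.rows, h.cols]
  · refine ⟨i.time, by simpa using i.count, fun a ha => ?_, by simpa using i.mem⟩
    have := i.frame a ha
    simp at ha
    simpa [ha] using this

end chop

/-- Constants, lengths, and base address of the second sequence. -/
def initProgram : Program :=
  .const 13 1 ⨾ .const 28 2 ⨾ .const 21 3 ⨾ .load 2 22 ⨾ .load 3 13 ⨾ .add 23 2 13

/-- Positions of the minima, and the output address of the point where the paths meet. -/
def minimaProgram : Program :=
  .add 18 13 22 ⨾ .add 17 2 22 ⨾ argminProgram ⨾ .add 4 19 22 ⨾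
  .add 18 23 22 ⨾ .add 17 3 22 ⨾ argminProgram ⨾ .add 5 19 22 ⨾
  .add 29 2 3 ⨾ .add 29 29 29 ⨾ .add 29 29 29

/-- The path from the minima downwards. -/
def bottomProgram : Program :=
  .const 6 (-1) ⨾ .add 7 4 22 ⨾ .add 8 5 22 ⨾ .add 9 4 22 ⨾ .add 10 5 22 ⨾ .add 11 29 22 ⨾
  .const 12 0 ⨾ chopProgram

/-- The path from the minima upwards, after the output address has been determined. -/
def topProgram : Program :=
  .sub 0 29 12 ⨾ .sub 0 0 12 ⨾ .add 0 0 28 ⨾ .sub 12 12 13 ⨾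
  .const 6 1 ⨾ .add 7 4 22 ⨾ .add 8 5 22 ⨾ .sub 9 2 4 ⨾ .add 9 9 13 ⨾ .sub 10 3 5 ⨾
  .add 10 10 13 ⨾ .add 11 29 22 ⨾ chopProgram ⨾ .add 1 12 22

/-- Split-and-Chop. -/
def splitAndChopProgram : Program :=
  initProgram ⨾ minimaProgram ⨾ bottomProgram ⨾ topProgram

section inputState

variable (r c : List ℤ)

theorem inputState_mem_zero : (inputState r c).mem 0 = r.length := by simp [inputState]

theorem inputState_mem_one : (inputState r c).mem 1 = c.length := by simp [inputState]

theorem inputState_mem_left {k : ℕ} (h1 : 1 ≤ k) (h : k ≤ r.length) :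
    (inputState r c).mem (1 + k) = elt r k := by
  obtain ⟨l, rfl⟩ : ∃ l, k = l + 1 := ⟨k - 1, by omega⟩
  have e : (1 + ((l + 1 : ℕ) : ℤ)).toNat = l + 1 + 1 := by omega
  simp only [inputState]
  rw [if_pos (by omega), e, List.getD_cons_succ, List.getD_cons_succ,
    List.getD_append _ _ _ _ (by omega), elt]
  rfl

theorem inputState_mem_right {k : ℕ} (h1 : 1 ≤ k) :
    (inputState r c).mem (r.length + 1 + k) = elt c k := by
  obtain ⟨l, rfl⟩ : ∃ l, k = l + 1 := ⟨k - 1, by omega⟩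
  have e : ((r.length : ℤ) + 1 + ((l + 1 : ℕ) : ℤ)).toNat = r.length + l + 1 + 1 := by omega
  simp only [inputState]
  rw [if_pos (by omega), e, List.getD_cons_succ, List.getD_cons_succ,
    List.getD_append_right _ _ _ _ (by omega), elt]
  congr 1
  omega

end inputState

/-- The registers that are fixed after the minima have been found. -/
structure Located (r c : List ℤ) (i j : ℕ) (σ : State) : Prop where
  one : σ.reg 13 = 1
  two : σ.reg 28 = 2
  three : σ.reg 21 = 3
  zero : σ.reg 22 = 0
  rows : σ.reg 2 = r.length
  cols : σ.reg 3 = c.length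
  base : σ.reg 23 = r.length + 1
  row : σ.reg 4 = i
  col : σ.reg 5 = j
  out : σ.reg 29 = 4 * (r.length + c.length)

theorem Located.of_frame {r c : List ℤ} {i j : ℕ} {σ τ : State} (h : Located r c i j σ)
    (hf : ∀ a, a ∉ [0, 1, 6, 7, 8, 9, 10, 11, 12, 14, 15, 16, 17, 18, 19, 24, 25, 26, 27] →
      τ.reg a = σ.reg a) : Located r c i j τ :=
  ⟨(hf _ (by simp)).trans h.one, (hf _ (by simp)).trans h.two, (hf _ (by simp)).trans h.three,
    (hf _ (by simp)).trans h.zero, (hf _ (by simp)).trans h.rows, (hf _ (by simp)).trans h.cols,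
    (hf _ (by simp)).trans h.base, (hf _ (by simp)).trans h.row, (hf _ (by simp)).trans h.col,
    (hf _ (by simp)).trans h.out⟩

variable {r c : List ℤ} {i j : ℕ}

theorem halts_init : Halts initProgram (inputState r c) fun t σ => t = 6 ∧
    σ.reg 13 = 1 ∧ σ.reg 28 = 2 ∧ σ.reg 21 = 3 ∧ σ.reg 22 = 0 ∧ σ.reg 2 = r.length ∧
    σ.reg 3 = c.length ∧ σ.reg 23 = r.length + 1 ∧ σ.mem = (inputState r c).mem := by
  apply halts_seq; apply halts_const
  apply halts_seq; apply halts_const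
  apply halts_seq; apply halts_const
  apply halts_seq; apply halts_load
  apply halts_seq; apply halts_load
  apply halts_add
  have e : (inputState r c).reg = fun _ => 0 := rfl
  simp [inputState_mem_zero, inputState_mem_one, e]

theorem halts_minima (hr : r ≠ []) (hc : c ≠ []) {σ : State} (h13 : σ.reg 13 = 1)
    (h28 : σ.reg 28 = 2) (h21 : σ.reg 21 = 3) (h22 : σ.reg 22 = 0) (h2 : σ.reg 2 = r.length)
    (h3 : σ.reg 3 = c.length) (h23 : σ.reg 23 = r.length + 1)
    (hm : σ.mem = (inputState r c).mem) :
    Halts minimaProgram σ fun t τ => t ≤ 10 * (r.length + c.length) + 40 ∧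
      τ.mem = (inputState r c).mem ∧
      ∃ i j, IsArgmin r i ∧ IsArgmin c j ∧ Located r c i j τ := by
  apply halts_seq; apply halts_add
  apply halts_seq; apply halts_add
  apply halts_seq
  refine (halts_argmin hr (by simpa using h13) (by simpa using h22) (by simp [h2, h22])
    (fun k hk hk' => by simpa [h13, h22, hm] using inputState_mem_left r c hk hk')).mono
    fun t₁ σ₁ s₁ => ?_
  obtain ⟨u₁, ⟨i, hi, hi'⟩, f₁, m₁⟩ := s₁
  simp [hm] at m₁
  have f13 := f₁ 13 (by simp)
  have f22 := f₁ 22 (by simp)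
  have f23 := f₁ 23 (by simp)
  have f3 := f₁ 3 (by simp)
  have f2 := f₁ 2 (by simp)
  have f28 := f₁ 28 (by simp)
  have f21 := f₁ 21 (by simp)
  simp [h13, h22, h23, h3, h2, h28, h21] at f13 f22 f23 f3 f2 f28 f21
  apply halts_seq; apply halts_add
  apply halts_seq; apply halts_add
  apply halts_seq; apply halts_add
  apply halts_seq
  refine (halts_argmin hc (by simpa using f13) (by simpa using f22) (by simp [f3, f22])
    (fun k hk hk' => by simpa [f22, f23, m₁] using inputState_mem_right r c hk)).mono
    fun t₂ σ₂ s₂ => ?_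
  obtain ⟨u₂, ⟨j, hj, hj'⟩, f₂, m₂⟩ := s₂
  simp [m₁] at m₂
  have g13 := f₂ 13 (by simp)
  have g22 := f₂ 22 (by simp)
  have g23 := f₂ 23 (by simp)
  have g3 := f₂ 3 (by simp)
  have g2 := f₂ 2 (by simp)
  have g28 := f₂ 28 (by simp)
  have g21 := f₂ 21 (by simp)
  have g4 := f₂ 4 (by simp)
  simp [f13, f22, f23, f3, f2, f28, f21, hi'] at g13 g22 g23 g3 g2 g28 g21 g4
  apply halts_seq; apply halts_add
  apply halts_seq; apply halts_add
  apply halts_seq; apply halts_add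
  apply halts_add
  refine ⟨by omega, by simpa using m₂, i, j, hi, hj, ?_⟩
  constructor <;> simp [g13, g22, g23, g3, g2, g28, g21, g4, hj']
  ring

theorem chop_length (A B : ℤ → ℤ) (d x y : ℤ) {u v : ℕ} (hu : 1 ≤ u) (hv : 1 ≤ v) :
    (chop A B d x y u v).length + 1 = u + v := by
  induction x, y, u, v using chop.induct A B d with
  | case1 x y u v h1 =>
    rw [chop, if_pos h1]
    simp
    omega
  | case2 x y u v h1 h2 =>
    rw [chop, if_neg h1, if_pos h2]
    simp
    omega
  | case3 x y u v h1 h2 h3 ih =>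
    rw [chop, if_neg h1, if_neg h2, if_pos h3]
    have := ih (by omega) hv
    simp
    omega
  | case4 x y u v h1 h2 h3 ih =>
    rw [chop, if_neg h1, if_neg h2, if_neg h3]
    have := ih hu (by omega)
    simp
    omega

theorem Located.chopPre_bottom {σ : State} (h : Located r c i j σ) (hi : IsArgmin r i)
    (hj : IsArgmin c j) (hm : σ.mem = (inputState r c).mem) (h6 : σ.reg 6 = -1)
    (h7 : σ.reg 7 = i) (h8 : σ.reg 8 = j) (h9 : σ.reg 9 = i) (h10 : σ.reg 10 = j)
    (h11 : σ.reg 11 = 4 * (r.length + c.length)) :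
    ChopPre (eltZ r) (eltZ c) (-1) i j i j (r.length + c.length + 1) σ := by
  have hi2 := hi.2.1
  have hj2 := hj.2.1
  refine ⟨h.one, h.two, h.three, h.zero, h6, h7, h8, h9, h10, hi.1, hj.1, ?_, ?_, ?_⟩
  · intro t ht
    omega
  · intro t ht
    refine ⟨by omega, ?_⟩
    have := inputState_mem_left r c (k := i - t) (by omega) (by omega)
    rw [hm, show (i : ℤ) + 1 + -1 * t = 1 + (i - t : ℕ) by omega, this,
      show (i : ℤ) + -1 * t = (i - t : ℕ) by omega, eltZ_natCast]
  · intro t ht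
    rw [h.base]
    refine ⟨by omega, ?_⟩
    have := inputState_mem_right r c (k := j - t) (by omega)
    rw [hm, show (j : ℤ) + (r.length + 1) + -1 * t = r.length + 1 + (j - t : ℕ) by omega, this,
      show (j : ℤ) + -1 * t = (j - t : ℕ) by omega, eltZ_natCast]

theorem Located.chopPre_top {σ : State} (h : Located r c i j σ) (hi : IsArgmin r i)
    (hj : IsArgmin c j)
    (hm : ∀ a : ℤ, a ≤ r.length + c.length + 1 → σ.mem a = (inputState r c).mem a)
    (h6 : σ.reg 6 = 1) (h7 : σ.reg 7 = i) (h8 : σ.reg 8 = j)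
    (h9 : σ.reg 9 = (r.length + 1 - i : ℕ)) (h10 : σ.reg 10 = (c.length + 1 - j : ℕ))
    (h11 : σ.reg 11 = 4 * (r.length + c.length)) :
    ChopPre (eltZ r) (eltZ c) 1 i j (r.length + 1 - i) (c.length + 1 - j)
      (r.length + c.length + 1) σ := by
  have hi1 := hi.1
  have hj1 := hj.1
  have hi2 := hi.2.1
  have hj2 := hj.2.1
  refine ⟨h.one, h.two, h.three, h.zero, h6, h7, h8, h9, h10, by omega, by omega, ?_, ?_, ?_⟩
  · intro t ht
    omega
  · intro t ht
    have h1 : (i : ℤ) + 1 + 1 * t ≤ r.length + c.length + 1 := by omega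
    refine ⟨h1, ?_⟩
    have := inputState_mem_left r c (k := i + t) (by omega) (by omega)
    rw [hm _ h1, show (i : ℤ) + 1 + 1 * t = 1 + (i + t : ℕ) by omega, this,
      show (i : ℤ) + 1 * t = (i + t : ℕ) by omega, eltZ_natCast]
  · intro t ht
    rw [h.base]
    have h1 : (j : ℤ) + (r.length + 1) + 1 * t ≤ r.length + c.length + 1 := by omega
    refine ⟨h1, ?_⟩
    have := inputState_mem_right r c (k := j + t) (by omega)
    rw [hm _ h1, show (j : ℤ) + (r.length + 1) + 1 * t = r.length + 1 + (j + t : ℕ) by omega, this,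
      show (j : ℤ) + 1 * t = (j + t : ℕ) by omega, eltZ_natCast]

theorem halts_bottom {σ : State} (h : Located r c i j σ) (hi : IsArgmin r i)
    (hj : IsArgmin c j) (hm : σ.mem = (inputState r c).mem) :
    Halts bottomProgram σ fun t τ => t ≤ 60 * (r.length + c.length) + 10 ∧ Located r c i j τ ∧
      τ.reg 12 = (chop (eltZ r) (eltZ c) (-1) i j i j).length ∧
      τ.mem = writePoints (-2) (4 * (r.length + c.length))
        (chop (eltZ r) (eltZ c) (-1) i j i j) (inputState r c).mem := by
  have hi2 := hi.2.1
  have hj2 := hj.2.1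
  apply halts_seq; apply halts_const
  apply halts_seq; apply halts_add
  apply halts_seq; apply halts_add
  apply halts_seq; apply halts_add
  apply halts_seq; apply halts_add
  apply halts_seq; apply halts_add
  apply halts_seq; apply halts_const
  refine (halts_chop (Located.chopPre_bottom (h.of_frame fun a ha => ?_) hi hj (by simpa using hm)
    (by simp) (by simp [h.row, h.zero]) (by simp [h.col, h.zero]) (by simp [h.row, h.zero])
    (by simp [h.col, h.zero]) (by simp [h.out, h.zero]))).mono fun t τ s => ?_
  · simp at ha
    simp [ha]
  · obtain ⟨t', rfl, u₁, n₁, f₁, m₁⟩ := s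
    refine ⟨by omega, h.of_frame fun a ha => ?_, by simpa using n₁, ?_⟩
    · rw [f₁ a (by simp at ha ⊢; tauto)]
      simp at ha
      simp [ha]
    · simpa [h.out, h.zero, hm] using m₁

theorem halts_top {σ : State} (h : Located r c i j σ) (hi : IsArgmin r i)
    (hj : IsArgmin c j)
    (hm : ∀ a : ℤ, a ≤ r.length + c.length + 1 → σ.mem a = (inputState r c).mem a) :
    Halts topProgram σ fun t τ => t ≤ 60 * (r.length + c.length + 2) + 20 ∧
      τ.reg 0 = 4 * (r.length + c.length) - 2 * (σ.reg 12 - 1) ∧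
      τ.reg 1 = σ.reg 12 - 1 + (chop (eltZ r) (eltZ c) 1 i j (r.length + 1 - i)
        (c.length + 1 - j)).length ∧
      τ.mem = writePoints 2 (4 * (r.length + c.length))
        (chop (eltZ r) (eltZ c) 1 i j (r.length + 1 - i) (c.length + 1 - j)) σ.mem := by
  have hi2 := hi.2.1
  have hj2 := hj.2.1
  apply halts_seq; apply halts_sub
  apply halts_seq; apply halts_sub
  apply halts_seq; apply halts_add
  apply halts_seq; apply halts_sub
  apply halts_seq; apply halts_const
  apply halts_seq; apply halts_add
  apply halts_seq; apply halts_add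
  apply halts_seq; apply halts_sub
  apply halts_seq; apply halts_add
  apply halts_seq; apply halts_sub
  apply halts_seq; apply halts_add
  apply halts_seq; apply halts_add
  apply halts_seq
  refine (halts_chop (Located.chopPre_top (h.of_frame fun a ha => ?_) hi hj (by simpa using hm)
    (by simp) (by simp [h.row, h.zero]) (by simp [h.col, h.zero])
    (by simp [h.row, h.rows, h.one]; omega)
    (by simp [h.col, h.cols, h.one]; omega) (by simp [h.out, h.zero]))).mono fun t τ s => ?_
  · simp at ha
    simp [ha]
  · obtain ⟨t', rfl, u₁, n₁, f₁, m₁⟩ := s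
    have e0 := f₁ 0 (by simp)
    have e22 := f₁ 22 (by simp)
    simp [h.out, h.zero, h.one, h.two] at e0 e22 n₁ m₁
    apply halts_add
    refine ⟨by omega, ?_, ?_, by simpa using m₁⟩
    · simp [e0]
      ring
    · simp [n₁, e22]

theorem holdsPath_of_writePoints (hi : IsArgmin r i) (hj : IsArgmin c j) {p : ℤ}
    {μ : ℤ → ℤ} {τ : State}
    (h0 : τ.reg 0 = p - 2 * ((chop (eltZ r) (eltZ c) (-1) i j i j).length - 1))
    (h1 : τ.reg 1 = (chop (eltZ r) (eltZ c) (-1) i j i j).length - 1 +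
      (chop (eltZ r) (eltZ c) 1 i j (r.length + 1 - i) (c.length + 1 - j)).length)
    (hm : τ.mem = writePoints 2 p
      (chop (eltZ r) (eltZ c) 1 i j (r.length + 1 - i) (c.length + 1 - j))
      (writePoints (-2) p (chop (eltZ r) (eltZ c) (-1) i j i j) μ)) :
    HoldsPath τ (splitAndChop r c i j) := by
  have hi1 := hi.1
  have hj1 := hj.1
  have hi2 := hi.2.1
  have hj2 := hj.2.1
  have e := map_toLattice_splitAndChop r c hi hj
  have lb := chop_length (eltZ r) (eltZ c) (-1) i j hi1 hj1
  have lt := chop_length (eltZ r) (eltZ c) 1 i j (show 1 ≤ r.length + 1 - i by omega)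
    (show 1 ≤ c.length + 1 - j by omega)
  set b := chop (eltZ r) (eltZ c) (-1) i j i j with hb
  set t := chop (eltZ r) (eltZ c) 1 i j (r.length + 1 - i) (c.length + 1 - j) with ht
  have len : (splitAndChop r c i j).length = b.length + (t.length - 1) := by
    simpa using congrArg List.length e
  have head : t.head? = b.head? := by
    have p1 := latticePath_chop (A := eltZ r) (B := eltZ c) (x := i) (y := j)
      (show 1 ≤ r.length + 1 - i by omega) (show 1 ≤ c.length + 1 - j by omega)
    have p2 := latticePath_reverse_chop (A := eltZ r) (B := eltZ c) (x := i) (y := j) hi1 hj1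
    rw [latticePath_iff] at p1 p2
    rw [← ht] at p1
    rw [← hb, List.getLast?_reverse] at p2
    rw [p1.1, p2.2.1]
  refine ⟨by rw [h1, len]; omega, fun ⟨h, hh⟩ => ?_⟩
  have hget : toLattice (splitAndChop r c i j)[h] = (b.reverse ++ t.tail)[h]'(by
      rw [← e]; simpa using hh) := by
    simp only [← e, List.getElem_map]
  rw [List.get_eq_getElem]
  change τ.mem (τ.reg 0 + 2 * (h : ℤ)) = (toLattice (splitAndChop r c i j)[h]).1 ∧
    τ.mem (τ.reg 0 + 2 * (h : ℤ) + 1) = (toLattice (splitAndChop r c i j)[h]).2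
  rw [hget, hm, h0]
  rcases lt_or_ge (h + 1) b.length with hlt | hge
  · rw [List.getElem_append_left (by simp; omega), List.getElem_reverse,
      show p - 2 * ((b.length : ℤ) - 1) + 2 * h = p + -2 * (b.length - 1 - h : ℕ) by omega,
      writePoints_apply_of_ne (l := t) (a := p + -2 * (b.length - 1 - h : ℕ)),
      writePoints_apply_of_ne (l := t) (a := p + -2 * (b.length - 1 - h : ℕ) + 1)]
    · exact writePoints_apply (by omega) (.inr rfl)
    · intro s hs
      omega
    · intro s hs
      omega
  · have key : (b.reverse ++ t.tail)[h]'(by rw [← e]; simpa using hh) =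
        t[h + 1 - b.length]'(by omega) := by
      rcases eq_or_ne (h + 1) b.length with heq | hne
      · rw [List.getElem_append_left (by simp; omega), List.getElem_reverse]
        have h1 : t[h + 1 - b.length]? = b[b.length - 1 - h]? := by
          rw [show h + 1 - b.length = 0 by omega, show b.length - 1 - h = 0 by omega,
            ← List.head?_eq_getElem?, ← List.head?_eq_getElem?, head]
        rw [List.getElem?_eq_getElem (by omega), List.getElem?_eq_getElem (by omega)] at h1
        exact (Option.some.inj h1).symm
      · rw [List.getElem_append_right (by simp; omega), List.getElem_tail]
        congr 1
        simp
        omega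
    rw [key, show p - 2 * ((b.length : ℤ) - 1) + 2 * h = p + 2 * (h + 1 - b.length : ℕ) by omega]
    exact writePoints_apply (by omega) (.inl rfl)

theorem outputsWithin_splitAndChop (hr : r ≠ []) (hc : c ≠ []) :
    ∃ i j, IsArgmin r i ∧ IsArgmin c j ∧
      OutputsWithin splitAndChopProgram r c (300 * (r.length + c.length))
        (splitAndChop r c i j) := by
  have hpos : 1 ≤ r.length := List.length_pos_iff.2 hr
  have H : Halts splitAndChopProgram (inputState r c) fun t τ =>
      ∃ i j, IsArgmin r i ∧ IsArgmin c j ∧ t ≤ 300 * (r.length + c.length) ∧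
        HoldsPath τ (splitAndChop r c i j) := by
    apply halts_seq
    refine halts_init.mono fun t₀ σ₀ s₀ => ?_
    obtain ⟨rfl, g1, g2, g3, g4, g5, g6, g7, g8⟩ := s₀
    apply halts_seq
    refine (halts_minima hr hc g1 g2 g3 g4 g5 g6 g7 g8).mono fun t₁ σ₁ s₁ => ?_
    obtain ⟨u₁, m₁, i, j, hi, hj, l₁⟩ := s₁
    have hi1 := hi.1
    have hj1 := hj.1
    have hi2 := hi.2.1
    have hj2 := hj.2.1
    have lb := chop_length (eltZ r) (eltZ c) (-1) i j hi1 hj1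
    apply halts_seq
    refine (halts_bottom l₁ hi hj m₁).mono fun t₂ σ₂ s₂ => ?_
    obtain ⟨u₂, l₂, n₂, m₂⟩ := s₂
    refine (halts_top l₂ hi hj ?_).mono fun t₃ σ₃ s₃ => ?_
    · intro a ha
      rw [m₂]
      refine writePoints_apply_of_ne fun t ht => ?_
      omega
    · obtain ⟨u₃, k0, k1, m₃⟩ := s₃
      rw [n₂] at k0 k1
      rw [m₂] at m₃
      exact ⟨i, j, hi, hj, by omega, holdsPath_of_writePoints hi hj k0 k1 m₃⟩
  obtain ⟨t, τ, he, i, j, hi, hj, ht, hp⟩ := H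
  exact ⟨i, j, hi, hj, t, τ, ht, he, hp⟩

end MergeDom

theorem mainTheorem8 :
    ∃ (P : MergeDom.Program) (C : ℕ), ∀ r c : List ℤ,
      r ≠ [] → c ≠ [] → MergeDom.IsTypical r → MergeDom.IsTypical c →
      (∀ i j : ℕ, MergeDom.IsArgmin r i → MergeDom.IsArgmin c j →
        MergeDom.IsDominatingPath r c (MergeDom.splitAndChop r c i j)) ∧
      (∃ i j : ℕ, MergeDom.IsArgmin r i ∧ MergeDom.IsArgmin c j ∧
        MergeDom.OutputsWithin P r c (C * (r.length + c.length))
          (MergeDom.splitAndChop r c i j)) :=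
  ⟨MergeDom.splitAndChopProgram, 300, fun _ _ hr hc hrt hct =>
    ⟨fun _ _ hi hj => MergeDom.isDominatingPath_splitAndChop hrt hct hi hj,
      MergeDom.outputsWithin_splitAndChop hr hc⟩⟩
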